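/- Let $\mathcal G=(G,E,\partial,\triangleright)$ be a finite crossed module, that is, $G,E$ are finite groups, $\partial:E\to G$ is a homomorphism and $\triangleright$ is an action of $G$ on $E$ by automorphisms with $\partial(X\triangleright e)=X\partial(e)X^{-1}$ and $\partial(e)\triangleright f=efe^{-1}$. Let $\mathcal C(\mathcal G)$ be the strict pivotal category with objects the elements of $G$ and arrows $X\xrightarrow{e}\partial(e)X$ $(e\in E)$, with composition $(\cdot\xrightarrow{e}\cdot\xrightarrow{f}\cdot)=(\cdot\xrightarrow{fe}\cdot)$, tensor product $(X\xrightarrow{e}\partial(e)X)\otimes(Y\xrightarrow{f}\partial(f)Y)=(XY\xrightarrow{e\,(X\triangleright f)}\partial(e)X\partial(f)Y)$, duals $X^*=X^{-1}$, and evaluations and coevaluations labelled by $1_E$. Let $D$ be an oriented dotted link diagram in the plane, i.e. an oriented link diagram with some bivalent vertices inserted, such that every component of the link carries at least one bivalent vertex, and let $\Gamma(D)$ be its underlying $4/2$-valent plane graph. A $\mathcal G$-colouring of $D$ assigns elements of $G$ to the edges of $\Gamma(D)$ and elements of $E$ to its vertices so that: at a bivalent vertex coloured $e$ the incoming edge has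 a colour $X$ and the outgoing edge has the colour $\partial(e)X$; at a crossing coloured $e$ and drawn with both strands directed upwards, both edges of the over-strand have the same colour $X$, and if the incoming edge of the under-strand has the colour $Y$, then its outgoing edge has the colour $\partial(e)XYX^{-1}$ when the over-strand runs from bottom left to top right (so $e$ is an arrow $X\otimes Y\to\partial(e)XYX^{-1}\otimes X$), and $X^{-1}\partial(e)YX$ when the over-strand runs from bottom right to top left (so $e$ is an arrow $Y\otimes X\to X\otimes X^{-1}\partial(e)YX$). A colouring is flat if the evaluation $1_G\to 1_G$ of the coloured plane graph in $\mathcal C(\mathcal G)$ is $1_E$. Put $$I^3_{\mathcal G}(D)=\frac{\#\{\text{flat colourings of }D\}}{(\#E)^{\#\{\text{vertices of }\Gamma(D)\}}}.$$ If $G$ is abelian, then the invariant $I^3_{\mathcal G}$ is trivial: $I^3_{\mathcal G}(D)=I^3_{\mathcal G}(D')$ whenever $D$ and $D'$ differ only in their crossing information, and more generally $I^3_{\mathcal G}(D)=I^3_{\mathcal G}(D')$ for any two oriented dotted link diagrams $D,D'$ of links with the same number of components; that is, $I^3_{\mathcal G}$ of a link equals its value on the trivial link with the same number of components. -/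

import Mathlib

/-- A crossed module `(G, E, ∂, ▷)`; the action `X ▷ e` of `G` on `E` by automorphisms is
written `X • e`. -/
structure CrossedModule (G E : Type*) [Group G] [Group E] [MulDistribMulAction G E] where
  /-- The boundary morphism `∂ : E → G`. -/
  bd : E →* G
  bd_smul : ∀ (X : G) (e : E), bd (X • e) = X * bd e * X⁻¹
  peiffer : ∀ e f : E, bd e • f = e * f * e⁻¹

/-- A morphism of the strict tensor category `C(𝒢)` of a crossed module: `label = e` is the
arrow `source --e--> ∂(e) source`. -/
structure CatMor (G E : Type*) where
  source : G
  label : E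

namespace CatMor

variable {G E : Type*} [Group G] [Group E] [MulDistribMulAction G E]

/-- The target `∂(e) X` of `X --e--> ∂(e) X`. -/
def target (𝒢 : CrossedModule G E) (f : CatMor G E) : G := 𝒢.bd f.label * f.source

/-- Identity morphisms. -/
def ident (X : G) : CatMor G E := ⟨X, 1⟩

/-- The composite "first `f`, then `g`"; it is only meaningful when the target of `f` is the
source of `g`. -/
def comp (f g : CatMor G E) : CatMor G E := ⟨f.source, g.label * f.label⟩

/-- The tensor product of morphisms, with label `e (X ▷ f)`. -/
def tensor (f g : CatMor G E) : CatMor G E :=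
  ⟨f.source * g.source, f.label * f.source • g.label⟩

end CatMor

/-- The direction of a strand of an oriented diagram at a horizontal level. -/
inductive Dir where
  | up
  | down

/-- The opposite direction. -/
def Dir.flip : Dir → Dir
  | .up => .down
  | .down => .up

/-- The object of `C(𝒢)` given by a strand coloured by `X`: it is `X` if the strand is directed
upwards and the dual `X* = X⁻¹` if it is directed downwards. -/
def Dir.object {G : Type*} [Group G] : Dir → G → G
  | .up, X => X
  | .down, X => X⁻¹

/-- The tensor product of the objects given by a row of coloured strands. -/
def rowObject {G : Type*} [Group G] (w : List Dir) (c : List G) : G :=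
  (List.zipWith Dir.object w c).prod

/-- The elementary pieces of an oriented dotted link diagram in general position with respect to
the height function, read from bottom to top:
* `cup d` is a local minimum, `cap d` is a local maximum; `d` is the direction of the left leg;
* `dot` is a bivalent vertex on an upward strand;
* `crossing b` is a crossing of two upward strands; if `b = true`, the strand going from bottom
  left to top right passes over, if `b = false` the strand going from bottom right to top left
  passes over.
Every diagram is planar isotopic to one made of these pieces (rotate crossings and bivalent
vertices until their strands point upwards). -/
inductive Piece where
  | cup (d : Dir)
  | cap (d : Dir)
  | dot
  | crossing (b : Bool)

namespace Piece

/-- The directions of the strands that enter the piece from below, from left to right. -/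
def bottom : Piece → List Dir
  | cup _ => []
  | cap d => [d, d.flip]
  | dot => [.up]
  | crossing _ => [.up, .up]

/-- The directions of the strands that leave the piece above, from left to right. -/
def top : Piece → List Dir
  | cup d => [d, d.flip]
  | cap _ => []
  | dot => [.up]
  | crossing _ => [.up, .up]

/-- Whether the piece contributes a vertex to the underlying `4/2`-valent graph. -/
def isVertex : Piece → Bool
  | cup _ => false
  | cap _ => false
  | dot => true
  | crossing _ => true

/-- Exchange the over- and the under-strand of a crossing. -/
def switch : Piece → Piece
  | crossing b => crossing (!b)
  | p => p

/-- The colouring rule: `s` and `t` are the colours of the strands at the bottom and at the top of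
the piece and `e` is the colour of the piece. Maxima and minima carry the (co)evaluation arrows of
the pivotal category `C(𝒢)`, whose label is `1`. A crossing or vertex is coloured by a morphism
from the product of its incoming edges to that of its outgoing ones, and the two edges of an
over-strand have the same colour. -/
def Rule {G E : Type*} [Group G] [Group E] [MulDistribMulAction G E] (𝒢 : CrossedModule G E) :
    Piece → List G → List G → E → Prop
  | cup _, s, t, e => ∃ X : G, s = [] ∧ t = [X, X] ∧ e = 1
  | cap _, s, t, e => ∃ X : G, s = [X, X] ∧ t = [] ∧ e = 1
  | dot, s, t, e => ∃ X : G, s = [X] ∧ t = [𝒢.bd e * X]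
  | crossing true, s, t, e => ∃ X Y : G, s = [X, Y] ∧ t = [𝒢.bd e * X * Y * X⁻¹, X]
  | crossing false, s, t, e => ∃ X Y : G, s = [Y, X] ∧ t = [X, X⁻¹ * 𝒢.bd e * Y * X]

end Piece

/-- A horizontal slice of a diagram: one elementary piece, with vertical strands on its left and on
its right. -/
structure Slice where
  left : List Dir
  piece : Piece
  right : List Dir

namespace Slice

def bottom (s : Slice) : List Dir := s.left ++ s.piece.bottom ++ s.right

def top (s : Slice) : List Dir := s.left ++ s.piece.top ++ s.right

end Slice

/-- An oriented link diagram in the plane, possibly with bivalent vertices ("dots"), cut into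
elementary horizontal slices. `row k` is the sequence of strands met by the `k`-th of the
horizontal lines that separate the slices. -/
structure LinkDiagram where
  height : ℕ
  row : Fin (height + 1) → List Dir
  slice : Fin height → Slice
  row_zero : row 0 = []
  row_last : row (Fin.last height) = []
  bottom_eq : ∀ k, (slice k).bottom = row k.castSucc
  top_eq : ∀ k, (slice k).top = row k.succ

namespace LinkDiagram

/-- The number of vertices (crossings and bivalent vertices) of the underlying graph. -/
noncomputable def numVertices (D : LinkDiagram) : ℕ :=
  Nat.card {k : Fin D.height // (D.slice k).piece.isVertex = true}

/-- The intersection points of the diagram with the horizontal lines separating the slices. -/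
def Point (D : LinkDiagram) : Type := (k : Fin (D.height + 1)) × Fin (D.row k).length

/-- The line of a point and its position on the line, counted from the left and from `0`. -/
def Point.coords {D : LinkDiagram} (p : D.Point) : ℕ × ℕ := (p.1, p.2)

/-- Two points are joined if some strand of the link runs from one to the other inside one slice;
strands go straight through crossings and bivalent vertices. -/
inductive Joined (D : LinkDiagram) : ℕ × ℕ → ℕ × ℕ → Prop
  | left (k : Fin D.height) (i : ℕ) (hi : i < (D.slice k).left.length) :
      Joined D (k, i) (k + 1, i)
  | right (k : Fin D.height) (j : ℕ) (hj : j < (D.slice k).right.length) :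
      Joined D (k, (D.slice k).left.length + (D.slice k).piece.bottom.length + j)
        (k + 1, (D.slice k).left.length + (D.slice k).piece.top.length + j)
  | cup (k : Fin D.height) (d : Dir) (h : (D.slice k).piece = .cup d) :
      Joined D (k + 1, (D.slice k).left.length) (k + 1, (D.slice k).left.length + 1)
  | cap (k : Fin D.height) (d : Dir) (h : (D.slice k).piece = .cap d) :
      Joined D (k, (D.slice k).left.length) (k, (D.slice k).left.length + 1)
  | dot (k : Fin D.height) (h : (D.slice k).piece = .dot) :
      Joined D (k, (D.slice k).left.length) (k + 1, (D.slice k).left.length)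
  | crossing_right (k : Fin D.height) (b : Bool) (h : (D.slice k).piece = .crossing b) :
      Joined D (k, (D.slice k).left.length) (k + 1, (D.slice k).left.length + 1)
  | crossing_left (k : Fin D.height) (b : Bool) (h : (D.slice k).piece = .crossing b) :
      Joined D (k, (D.slice k).left.length + 1) (k + 1, (D.slice k).left.length)

/-- The components of the link: classes of points for the equivalence relation generated by
`Joined`. -/
def Component (D : LinkDiagram) : Type :=
  Quot fun p q : D.Point => D.Joined p.coords q.coords

/-- The component of the link through a point. -/
def component (D : LinkDiagram) (p : D.Point) : D.Component := Quot.mk _ p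

/-- The number of components of the link. -/
noncomputable def numComponents (D : LinkDiagram) : ℕ := Nat.card D.Component

/-- Every component of the link carries at least one bivalent vertex. -/
def IsDotted (D : LinkDiagram) : Prop :=
  ∀ x : D.Component, ∃ (k : Fin D.height) (q : D.Point), (D.slice k).piece = .dot ∧
    q.coords = ((k : ℕ), (D.slice k).left.length) ∧ D.component q = x

/-- The diagram with the same underlying graph and other crossing information: the crossings in the
slices `k` with `f k = true` are switched. -/
def changeCrossings (D : LinkDiagram) (f : Fin D.height → Bool) : LinkDiagram where
  height := D.height
  row := D.row
  slice k :=
    { left := (D.slice k).left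
      piece := if f k then (D.slice k).piece.switch else (D.slice k).piece
      right := (D.slice k).right }
  row_zero := D.row_zero
  row_last := D.row_last
  bottom_eq k := by
    rw [← D.bottom_eq k]
    cases f k <;> cases h : (D.slice k).piece <;>
      simp [Slice.bottom, Piece.bottom, Piece.switch, h]
  top_eq k := by
    rw [← D.top_eq k]
    cases f k <;> cases h : (D.slice k).piece <;>
      simp [Slice.top, Piece.top, Piece.switch, h]

/-- A `𝒢`-colouring of a diagram. `colour k` lists the colours of the strands met by the `k`-th
horizontal line, `label k` is the colour of the piece in the `k`-th slice. Colours are constant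
along the vertical strands of a slice, and obey `Piece.Rule` at its piece. -/
@[ext]
structure Colouring {G E : Type*} [Group G] [Group E] [MulDistribMulAction G E]
    (𝒢 : CrossedModule G E) (D : LinkDiagram) where
  colour : Fin (D.height + 1) → List G
  label : Fin D.height → E
  length_eq : ∀ k, (colour k).length = (D.row k).length
  left_eq : ∀ k, (colour k.succ).take (D.slice k).left.length =
    (colour k.castSucc).take (D.slice k).left.length
  right_eq : ∀ k,
    (colour k.succ).drop ((D.slice k).left.length + (D.slice k).piece.top.length) =
      (colour k.castSucc).drop ((D.slice k).left.length + (D.slice k).piece.bottom.length)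
  rule : ∀ k, (D.slice k).piece.Rule 𝒢
    (((colour k.castSucc).drop (D.slice k).left.length).take (D.slice k).piece.bottom.length)
    (((colour k.succ).drop (D.slice k).left.length).take (D.slice k).piece.top.length)
    (label k)

namespace Colouring

variable {G E : Type*} [Group G] [Group E] [MulDistribMulAction G E]
  {𝒢 : CrossedModule G E} {D : LinkDiagram}

/-- The morphism of `C(𝒢)` given by the `k`-th slice: the identity of the strands on the left,
tensor the morphism at the piece, tensor the identity of the strands on the right. -/
def sliceMor (c : Colouring 𝒢 D) (k : Fin D.height) : CatMor G E :=
  let s := D.slice k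
  let row := c.colour k.castSucc
  ((CatMor.ident (rowObject s.left (row.take s.left.length))).tensor
    ⟨rowObject s.piece.bottom ((row.drop s.left.length).take s.piece.bottom.length),
      c.label k⟩).tensor
    (CatMor.ident (rowObject s.right (row.drop (s.left.length + s.piece.bottom.length))))

/-- The evaluation `1_G → 1_G` of the coloured planar graph in the pivotal category `C(𝒢)`: the
composite of the morphisms of the slices, from bottom to top. -/
def eval (c : Colouring 𝒢 D) : CatMor G E :=
  (List.ofFn c.sliceMor).foldl CatMor.comp (CatMor.ident 1)

/-- A colouring is flat if its evaluation is `1_E`. -/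
def IsFlat (c : Colouring 𝒢 D) : Prop := c.eval.label = 1

end Colouring

/-- The `3`-dimensional state sum
`I³_𝒢(D) = #{flat colourings of D} / #E ^ #{vertices of the underlying graph of D}`. -/
noncomputable def stateSum {G E : Type*} [Group G] [Group E] [MulDistribMulAction G E]
    (𝒢 : CrossedModule G E) (D : LinkDiagram) : ℚ :=
  (Nat.card {c : Colouring 𝒢 D // c.IsFlat} : ℚ) / (Nat.card E : ℚ) ^ D.numVertices

end LinkDiagram

/-! For abelian `G` the conjugations in the crossing rule cancel: a crossing labelled `e` passes the
colour of the over-strand on and multiplies that of the under-strand by `∂(e)`. So a colouring is a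
`G`-valued function along the link that is constant except for one jump by `∂(e)` at each vertex.
The crossing information only decides which of the two strands jumps.

Counting colourings. Orient the link and let `next` be the resulting permutation of the points.
Modulo `∂(E)` a colouring is constant on each component, which gives `#(G/∂(E))` choices per
component. Since every component has a dot, every point has a marked point ahead of it. The
colouring is determined by its values at the marks, and these are arbitrary in the chosen coset,
giving `#∂(E)` choices per vertex. Each jump then has `#ker ∂` possible labels, and `#∂(E) * #ker ∂
= #E`. This is `card_marked_labellings`, carried over to diagrams by `colouring_iff` and
`card_colouring`.

Flatness. The evaluation is an arrow from `1` to `1`, so its label lies in `ker ∂`, which is central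
by the Peiffer identity. Multiplying the label of one vertex by an element of `ker ∂` gives another
colouring and multiplies the evaluation by a translate of that element. So all values in `ker ∂` are
taken equally often (`equivFlat`), and flat colourings are a fraction `1 / #ker ∂` of all. The state
sum of a nonempty link is therefore `#(G/∂(E)) ^ #components / #ker ∂`, which depends on the number
of components only (`stateSum_eq`). -/

/-! ### Counting functions along the cycles of a permutation with marked points -/

section Counting

variable {P V G E : Type*}

/-- A function constant along the orbits of `σ` except at the marked points `t v` is determined by
its values there: every point has a first marked point ahead of it. -/
theorem exists_first_mark (σ : Equiv.Perm P) (t : V → P) (ht : Function.Injective t)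
    (hd : ∀ p, ∃ (n : ℕ) (v : V), (σ ^ n) p = t v) :
    ∃ F : P → V, (∀ v, F (t v) = v) ∧ ∀ p, p ∉ Set.range t → F (σ p) = F p := by
  classical
  have hd' := fun p => Nat.find_spec (hd p)
  choose F hF using hd'
  refine ⟨F, fun v => ?_, fun p hp => ?_⟩
  · have h0 : Nat.find (hd (t v)) = 0 := by
      rw [Nat.find_eq_zero]; exact ⟨v, rfl⟩
    have := hF (t v)
    rw [h0] at this
    exact (ht this).symm
  -- From an unmarked `p` the search for a mark takes exactly one step more than from `σ p`, so both
  -- end at the same mark.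
  · have h : Nat.find (hd p) = Nat.find (hd (σ p)) + 1 := by
      have := Nat.find_comp_succ (hd p)
        (by simpa only [pow_succ, Equiv.Perm.mul_apply] using hd (σ p))
        (by rintro ⟨v, hv⟩; exact hp ⟨v, hv.symm⟩)
      rw [this]
      congr 1
    apply ht
    rw [← hF, ← hF, h, pow_succ, Equiv.Perm.mul_apply]

/-- Induction on the number of steps to a mark: a property is carried backwards along the orbit,
from each mark to the unmarked points before it. -/
theorem mark_induction (σ : Equiv.Perm P) (t : V → P)
    (hd : ∀ p, ∃ (n : ℕ) (v : V), (σ ^ n) p = t v) {Q : P → Prop} (h0 : ∀ v, Q (t v))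
    (h1 : ∀ p, p ∉ Set.range t → Q (σ p) → Q p) (p : P) : Q p := by
  obtain ⟨n, v, hv⟩ := hd p
  induction n generalizing p with
  | zero =>
    have : p = t v := by simpa using hv
    exact this ▸ h0 v
  | succ n ih =>
    by_cases hp : p ∈ Set.range t
    · obtain ⟨w, rfl⟩ := hp; exact h0 w
    · exact h1 p hp (ih _ (by rwa [pow_succ, Equiv.Perm.mul_apply] at hv))

theorem card_fibre_monoidHom [Group G] [Group E] (f : E →* G) {g : G} (hg : g ∈ f.range) :
    Nat.card {e // f e = g} = Nat.card f.ker := by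
  obtain ⟨e₀, rfl⟩ := hg
  refine Nat.card_congr ⟨fun e => ⟨e₀⁻¹ * e.1, ?_⟩, fun k => ⟨e₀ * k.1, ?_⟩, ?_, ?_⟩
  · simp [MonoidHom.mem_ker, e.2]
  · simpa using MonoidHom.mem_ker.1 k.2
  · intro e; simp
  · intro e; simp

theorem card_fibre_mk [CommGroup G] (A : Subgroup G) (y : G ⧸ A) :
    Nat.card {g : G // (g : G ⧸ A) = y} = Nat.card A := by
  have := card_fibre_monoidHom (QuotientGroup.mk' A) (g := y)
    (by rw [MonoidHom.range_eq_top.2 (QuotientGroup.mk'_surjective A)]; trivial)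
  simpa using this

theorem card_ker_mul_card_range [Group G] [Group E] (f : E →* G) :
    Nat.card f.ker * Nat.card f.range = Nat.card E := by
  rw [← Subgroup.index_ker, Subgroup.card_mul_index]

/-- Link components are generated by a relation that ignores orientation. This places them inside
cycles of `σ`, so that a mark on a component is reached by moving forwards only. -/
theorem sameCycle_of_quot_eq (σ : Equiv.Perm P) (r : P → P → Prop)
    (hr : ∀ p q, r p q → q = σ p ∨ p = σ q) {p q : P} (h : Quot.mk r p = Quot.mk r q) :
    σ.SameCycle p q := by
  have h' := Quot.eqvGen_exact h
  clear h
  induction h' with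
  | rel p q h =>
    rcases hr p q h with rfl | rfl
    · exact ⟨1, by simp⟩
    · exact ⟨-1, by simp⟩
  | refl p => exact .refl _ _
  | symm _ _ _ ih => exact ih.symm
  | trans _ _ _ _ _ ih₁ ih₂ => exact ih₁.trans ih₂

variable [CommGroup G] [Group E] [Finite P] [Finite V] [Finite G] [Finite E]

/-- The functions which are constant along the orbits of `σ` except at the marked points, where they
change by elements of `A`. -/
theorem card_marked_functions (σ : Equiv.Perm P) (t : V → P) (ht : Function.Injective t)
    (r : P → P → Prop) (hr : ∀ p q, r p q → q = σ p ∨ p = σ q)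
    (hσ : ∀ p, Quot.mk r (σ p) = Quot.mk r p) (hd : ∀ x : Quot r, ∃ v, Quot.mk r (t v) = x)
    (A : Subgroup G) :
    Nat.card {x : P → G // (∀ p, p ∉ Set.range t → x (σ p) = x p) ∧
      ∀ v, x (σ (t v)) / x (t v) ∈ A} =
      Nat.card (G ⧸ A) ^ Nat.card (Quot r) * Nat.card A ^ Nat.card V := by
  classical
  have hd' : ∀ p, ∃ (n : ℕ) (v : V), (σ ^ n) p = t v := by
    intro p
    obtain ⟨v, hv⟩ := hd (Quot.mk r p)
    obtain ⟨n, hn⟩ := (sameCycle_of_quot_eq σ r hr hv.symm).exists_nat_pow_eq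
    exact ⟨n, v, hn⟩
  obtain ⟨F, hF, hF'⟩ := exists_first_mark σ t ht hd'
  have hFq : ∀ p, Quot.mk r (t (F p)) = Quot.mk r p := by
    refine mark_induction σ t hd' (fun v => by rw [hF]) fun p hp h => ?_
    rw [hF' p hp, hσ] at h
    exact h
  let S := {x : P → G // (∀ p, p ∉ Set.range t → x (σ p) = x p) ∧
      ∀ v, x (σ (t v)) / x (t v) ∈ A}
  -- Modulo `A` nothing jumps, so the coset of the value descends to the classes of `r`.
  have hstep : ∀ (x : S) p, ((x.1 (σ p) : G) : G ⧸ A) = x.1 p := by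
    intro x p
    by_cases hp : p ∈ Set.range t
    · obtain ⟨v, rfl⟩ := hp
      rw [eq_comm, QuotientGroup.eq, mul_comm, ← div_eq_mul_inv]
      exact x.2.2 v
    · rw [x.2.1 p hp]
  -- The data are a coset `y` for each class and, at each mark, a representative of the coset of its
  -- class. The value at any other point is read off at the first mark ahead, given by `F`.
  let Φ : S ≃ (y : Quot r → G ⧸ A) × ((v : V) → {g : G // (g : G ⧸ A) = y (Quot.mk r (t v))}) :=
    { toFun := fun x => ⟨Quot.lift (fun p => (x.1 p : G ⧸ A)) (by
          intro p q hpq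
          rcases hr p q hpq with rfl | rfl
          · exact (hstep x p).symm
          · exact hstep x q), fun v => ⟨x.1 (t v), rfl⟩⟩
      invFun := fun z => ⟨fun p => (z.2 (F p)).1, fun p hp =>
        congrArg (fun v => (z.2 v).1) (hF' p hp), fun v => by
        rw [div_eq_mul_inv, mul_comm, ← QuotientGroup.eq, (z.2 _).2, (z.2 _).2, hFq, hFq, hσ]⟩
      left_inv := by
        intro x
        apply Subtype.ext
        funext p
        refine mark_induction (Q := fun p => x.1 (t (F p)) = x.1 p) σ t hd'
          (fun v => by rw [hF]) (fun p hp h => ?_) p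
        rwa [hF' p hp, x.2.1 p hp] at h
      right_inv := by
        rintro ⟨y, g⟩
        have hy : (Quot.lift (fun p => ((g (F p)).1 : G ⧸ A)) (by
            intro p q hpq
            have : Quot.mk r p = Quot.mk r q := Quot.sound hpq
            rw [(g _).2, (g _).2, hFq, hFq, this]) : Quot r → G ⧸ A) = y := by
          funext x
          induction x using Quot.ind with
          | mk p => exact (g (F p)).2.trans (by rw [hFq])
        refine Sigma.ext hy ?_
        refine Function.hfunext rfl ?_
        rintro v _ ⟨⟩
        refine (Subtype.heq_iff_coe_eq ?_).2 ?_
        · intro a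
          exact iff_of_eq (congrArg
            (fun y' : Quot r → G ⧸ A => (a : G ⧸ A) = y' (Quot.mk r (t v))) hy)
        · change (g (F (t v))).1 = (g v).1
          rw [hF] }
  have : Finite (Quot r) := Quot.finite r
  have := Fintype.ofFinite V
  have := Fintype.ofFinite (Quot r → G ⧸ A)
  rw [Nat.card_congr Φ, Nat.card_sigma]
  simp_rw [Nat.card_pi, card_fibre_mk]
  simp [Finset.card_univ, ← Nat.card_eq_fintype_card, Nat.card_fun]

/-- Once the function is fixed, the labels allowed at a mark form a fibre of `f` over an element of
its range, hence a coset of `f.ker`. The factors `#f.range` and `#f.ker` at each mark combine to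
`#E`. -/
theorem card_marked_labellings (σ : Equiv.Perm P) (t : V → P) (ht : Function.Injective t)
    (r : P → P → Prop) (hr : ∀ p q, r p q → q = σ p ∨ p = σ q)
    (hσ : ∀ p, Quot.mk r (σ p) = Quot.mk r p) (hd : ∀ x : Quot r, ∃ v, Quot.mk r (t v) = x)
    (f : E →* G) :
    Nat.card {z : (P → G) × (V → E) // (∀ p, p ∉ Set.range t → z.1 (σ p) = z.1 p) ∧
      ∀ v, z.1 (σ (t v)) = f (z.2 v) * z.1 (t v)} =
      Nat.card (G ⧸ f.range) ^ Nat.card (Quot r) * Nat.card E ^ Nat.card V := by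
  classical
  let S := {x : P → G // (∀ p, p ∉ Set.range t → x (σ p) = x p) ∧
      ∀ v, x (σ (t v)) / x (t v) ∈ f.range}
  let Φ : {z : (P → G) × (V → E) // (∀ p, p ∉ Set.range t → z.1 (σ p) = z.1 p) ∧
      ∀ v, z.1 (σ (t v)) = f (z.2 v) * z.1 (t v)} ≃
      (x : S) × ((v : V) → {e : E // f e = x.1 (σ (t v)) / x.1 (t v)}) :=
    { toFun := fun z => ⟨⟨z.1.1, z.2.1, fun v => ⟨z.1.2 v, eq_div_of_mul_eq' (z.2.2 v).symm⟩⟩,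
        fun v => ⟨z.1.2 v, eq_div_of_mul_eq' (z.2.2 v).symm⟩⟩
      invFun := fun z => ⟨(z.1.1, fun v => (z.2 v).1), z.1.2.1, fun v => by simp [(z.2 v).2]⟩
      left_inv := fun z => rfl
      right_inv := fun z => rfl }
  have := Fintype.ofFinite V
  have := Fintype.ofFinite S
  rw [Nat.card_congr Φ, Nat.card_sigma]
  simp_rw [Nat.card_pi]
  rw [Finset.sum_congr rfl fun x _ => Finset.prod_congr rfl fun v _ =>
    card_fibre_monoidHom f (x.2.2 v)]
  rw [Finset.sum_const, Finset.prod_const, Finset.card_univ, Finset.card_univ,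
    ← Nat.card_eq_fintype_card, ← Nat.card_eq_fintype_card,
    card_marked_functions σ t ht r hr hσ hd, smul_eq_mul, mul_assoc, ← mul_pow,
    mul_comm (Nat.card f.range), card_ker_mul_card_range]

end Counting

/-! ### Strands inside one slice -/

namespace Slice

/-- A strand of the slice runs from its `i`-th bottom end to its `j`-th top end. -/
def Thread (s : Slice) (i j : ℕ) : Prop :=
  (i < s.left.length ∧ j = i) ∨
  (∃ m < s.right.length, i = s.left.length + s.piece.bottom.length + m ∧
    j = s.left.length + s.piece.top.length + m) ∨
  (s.piece = .dot ∧ i = s.left.length ∧ j = s.left.length) ∨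
  (∃ b, s.piece = .crossing b) ∧ ((i = s.left.length ∧ j = s.left.length + 1) ∨
    (i = s.left.length + 1 ∧ j = s.left.length))

/-- The `i`-th and the `j`-th bottom end of the slice are joined by a maximum. -/
def CapPair (s : Slice) (i j : ℕ) : Prop :=
  (∃ d, s.piece = .cap d) ∧ ((i = s.left.length ∧ j = s.left.length + 1) ∨
    (i = s.left.length + 1 ∧ j = s.left.length))

/-- The `i`-th and the `j`-th top end of the slice are joined by a minimum. -/
def CupPair (s : Slice) (i j : ℕ) : Prop :=
  (∃ d, s.piece = .cup d) ∧ ((i = s.left.length ∧ j = s.left.length + 1) ∨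
    (i = s.left.length + 1 ∧ j = s.left.length))

variable {s : Slice} {i j i' j' : ℕ}

theorem Thread.right_unique (h : s.Thread i j) (h' : s.Thread i j') : j = j' := by
  rcases s with ⟨l, p, r⟩
  cases p <;> simp [Thread, Piece.bottom, Piece.top] at h h' <;> grind

theorem Thread.left_unique (h : s.Thread i j) (h' : s.Thread i' j) : i = i' := by
  rcases s with ⟨l, p, r⟩
  cases p <;> simp [Thread, Piece.bottom, Piece.top] at h h' <;> grind

theorem CapPair.symm (h : s.CapPair i j) : s.CapPair j i := ⟨h.1, by have := h.2; omega⟩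

theorem CupPair.symm (h : s.CupPair i j) : s.CupPair j i := ⟨h.1, by have := h.2; omega⟩

theorem CapPair.right_unique (h : s.CapPair i j) (h' : s.CapPair i j') : j = j' := by
  have := h.2; have := h'.2; omega

theorem CupPair.right_unique (h : s.CupPair i j) (h' : s.CupPair i j') : j = j' := by
  have := h.2; have := h'.2; omega

theorem Thread.not_capPair (h : s.Thread i j) : ¬ s.CapPair i j' := by
  intro h'
  rcases s with ⟨l, p, r⟩
  cases p <;> (simp [Thread, CapPair, Piece.bottom, Piece.top] at h h'; try grind)

theorem Thread.not_cupPair (h : s.Thread i j) : ¬ s.CupPair j j' := by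
  intro h'
  rcases s with ⟨l, p, r⟩
  cases p <;> (simp [Thread, CupPair, Piece.bottom, Piece.top] at h h'; try grind)

theorem exists_thread_or_capPair (h : i < s.bottom.length) :
    (∃ j, s.Thread i j) ∨ ∃ j, s.CapPair i j := by
  rcases lt_or_ge i s.left.length with h₁ | h₁
  · exact .inl ⟨i, .inl ⟨h₁, rfl⟩⟩
  rcases lt_or_ge i (s.left.length + s.piece.bottom.length) with h₂ | h₂
  · rcases s with ⟨l, p, r⟩
    cases p <;> simp [Thread, CapPair, Piece.bottom, Piece.top] at * <;> grind
  · simp only [bottom, List.length_append] at h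
    exact .inl ⟨_, .inr (.inl ⟨i - (s.left.length + s.piece.bottom.length),
      by omega, by omega, rfl⟩)⟩

theorem exists_thread_or_cupPair (h : j < s.top.length) :
    (∃ i, s.Thread i j) ∨ ∃ i, s.CupPair j i := by
  rcases lt_or_ge j s.left.length with h₁ | h₁
  · exact .inl ⟨j, .inl ⟨h₁, rfl⟩⟩
  rcases lt_or_ge j (s.left.length + s.piece.top.length) with h₂ | h₂
  · rcases s with ⟨l, p, r⟩
    cases p <;> simp [Thread, CupPair, Piece.bottom, Piece.top] at * <;> grind
  · simp only [top, List.length_append] at h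
    exact .inl ⟨_, .inr (.inl ⟨j - (s.left.length + s.piece.top.length),
      by omega, rfl, by omega⟩)⟩

/-- Crossings and dots have upward strands only, so a strand crossing the slice keeps its direction;
only maxima and minima reverse it. -/
theorem Thread.exists_dir (h : s.Thread i j) : ∃ d, s.bottom[i]? = some d ∧ s.top[j]? = some d := by
  rcases s with ⟨l, p, r⟩
  rcases h with ⟨hi, rfl⟩ | ⟨m, hm, rfl, rfl⟩ | ⟨hp, rfl, rfl⟩ | ⟨⟨b, hp⟩, ⟨rfl, rfl⟩ | ⟨rfl, rfl⟩⟩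
  · simp only at hi
    exact ⟨l[j], by simp [bottom, top, List.getElem?_append, hi]⟩
  · simp only at hm
    exact ⟨r[m], by simp [bottom, top, hm, add_assoc]⟩
  all_goals
    simp only at hp; subst hp
    exact ⟨.up, by simp [bottom, top, Piece.bottom, Piece.top]⟩

theorem CapPair.exists_dir (h : s.CapPair i j) :
    ∃ d : Dir, s.bottom[i]? = some d ∧ s.bottom[j]? = some d.flip := by
  rcases s with ⟨l, p, r⟩
  obtain ⟨⟨d, hp⟩, ⟨rfl, rfl⟩ | ⟨rfl, rfl⟩⟩ := h <;> simp only at hp <;> subst hp <;> cases d <;>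
    simp [bottom, Piece.bottom, Dir.flip]

theorem CupPair.exists_dir (h : s.CupPair i j) :
    ∃ d : Dir, s.top[i]? = some d ∧ s.top[j]? = some d.flip := by
  rcases s with ⟨l, p, r⟩
  obtain ⟨⟨d, hp⟩, ⟨rfl, rfl⟩ | ⟨rfl, rfl⟩⟩ := h <;> simp only at hp <;> subst hp <;> cases d <;>
    simp [top, Piece.top, Dir.flip]

end Slice

/-! ### The successor permutation along the oriented link -/

namespace LinkDiagram

variable {D : LinkDiagram}

/-- The direction of the strand at given coordinates. -/
def dirAt (D : LinkDiagram) (a : ℕ × ℕ) : Option Dir :=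
  if h : a.1 < D.height + 1 then (D.row ⟨a.1, h⟩)[a.2]? else none

theorem dirAt_bottom (k : Fin D.height) (i : ℕ) : D.dirAt (k, i) = (D.slice k).bottom[i]? := by
  have : (k : ℕ) < D.height + 1 := by omega
  simp only [dirAt, this, dif_pos, D.bottom_eq]
  rfl

theorem dirAt_top (k : Fin D.height) (i : ℕ) : D.dirAt (k + 1, i) = (D.slice k).top[i]? := by
  have : (k : ℕ) + 1 < D.height + 1 := by omega
  simp only [dirAt, this, dif_pos, D.top_eq]
  rfl

theorem Point.coords_injective : Function.Injective (Point.coords (D := D)) := by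
  rintro ⟨k, i⟩ ⟨k', i'⟩ h
  simp only [Point.coords, Prod.mk.injEq] at h
  obtain ⟨h₁, h₂⟩ := h
  obtain rfl := Fin.ext h₁
  obtain rfl := Fin.ext h₂
  rfl

theorem Point.exists_dirAt (p : D.Point) : ∃ d, D.dirAt p.coords = some d := by
  rcases p with ⟨k, i⟩
  exact ⟨(D.row k)[i], by simp [dirAt, Point.coords, Nat.lt_succ_iff.1 k.2]⟩

theorem exists_point {a : ℕ × ℕ} {d : Dir} (h : D.dirAt a = some d) :
    ∃ p : D.Point, p.coords = a := by
  rcases a with ⟨k, i⟩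
  simp only [dirAt] at h
  split at h
  case isTrue hk =>
    obtain ⟨hi, -⟩ := List.getElem?_eq_some_iff.1 h
    exact ⟨⟨⟨k, hk⟩, ⟨i, hi⟩⟩, rfl⟩
  case isFalse => simp at h

/-- Following the orientation of the link through one slice leads from `p` to `q`. -/
def Step (D : LinkDiagram) (p q : ℕ × ℕ) : Prop :=
  ∃ k : Fin D.height,
    (p.1 = k ∧ q.1 = k + 1 ∧ (D.slice k).Thread p.2 q.2 ∧
      D.dirAt p = some .up ∧ D.dirAt q = some .up) ∨
    (p.1 = k + 1 ∧ q.1 = k ∧ (D.slice k).Thread q.2 p.2 ∧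
      D.dirAt p = some .down ∧ D.dirAt q = some .down) ∨
    (p.1 = k ∧ q.1 = k ∧ (D.slice k).CapPair p.2 q.2 ∧
      D.dirAt p = some .up ∧ D.dirAt q = some .down) ∨
    (p.1 = k + 1 ∧ q.1 = k + 1 ∧ (D.slice k).CupPair p.2 q.2 ∧
      D.dirAt p = some .down ∧ D.dirAt q = some .up)

theorem step_of_thread {k : Fin D.height} {i j : ℕ} (h : (D.slice k).Thread i j) :
    D.Step (k, i) (k + 1, j) ∧ D.dirAt (k, i) = some .up ∨
      D.Step (k + 1, j) (k, i) ∧ D.dirAt (k + 1, j) = some .down := by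
  obtain ⟨d, h₁, h₂⟩ := h.exists_dir
  rw [← dirAt_bottom] at h₁
  rw [← dirAt_top] at h₂
  cases d
  · exact .inl ⟨⟨k, .inl ⟨rfl, rfl, h, h₁, h₂⟩⟩, h₁⟩
  · exact .inr ⟨⟨k, .inr (.inl ⟨rfl, rfl, h, h₂, h₁⟩)⟩, h₂⟩

theorem step_of_capPair {k : Fin D.height} {i j : ℕ} (h : (D.slice k).CapPair i j) :
    D.Step (k, i) (k, j) ∧ D.dirAt (k, i) = some .up ∨
      D.Step (k, j) (k, i) ∧ D.dirAt (k, j) = some .up := by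
  obtain ⟨d, h₁, h₂⟩ := h.exists_dir
  rw [← dirAt_bottom] at h₁ h₂
  cases d
  · exact .inl ⟨⟨k, .inr (.inr (.inl ⟨rfl, rfl, h, h₁, h₂⟩))⟩, h₁⟩
  · exact .inr ⟨⟨k, .inr (.inr (.inl ⟨rfl, rfl, h.symm, h₂, h₁⟩))⟩, h₂⟩

theorem step_of_cupPair {k : Fin D.height} {i j : ℕ} (h : (D.slice k).CupPair i j) :
    D.Step (k + 1, i) (k + 1, j) ∧ D.dirAt (k + 1, i) = some .down ∨
      D.Step (k + 1, j) (k + 1, i) ∧ D.dirAt (k + 1, j) = some .down := by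
  obtain ⟨d, h₁, h₂⟩ := h.exists_dir
  rw [← dirAt_top] at h₁ h₂
  cases d
  · exact .inr ⟨⟨k, .inr (.inr (.inr ⟨rfl, rfl, h.symm, h₂, h₁⟩))⟩, h₂⟩
  · exact .inl ⟨⟨k, .inr (.inr (.inr ⟨rfl, rfl, h, h₁, h₂⟩))⟩, h₁⟩

/-- The direction at `p` tells whether the link continues into the slice above or below. In that
slice `p` is the end of a single strand, which either crosses the slice or turns back. -/
theorem Step.right_unique {p q q' : ℕ × ℕ} (h : D.Step p q) (h' : D.Step p q') : q = q' := by
  rcases p with ⟨a, i⟩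
  rcases q with ⟨b, j⟩
  rcases q' with ⟨b', j'⟩
  obtain ⟨k, h⟩ := h
  obtain ⟨k', h'⟩ := h'
  simp only at h h'
  rcases h with ⟨h₁, h₂, h₃, h₄, h₅⟩ | ⟨h₁, h₂, h₃, h₄, h₅⟩ | ⟨h₁, h₂, h₃, h₄, h₅⟩ |
      ⟨h₁, h₂, h₃, h₄, h₅⟩ <;>
    rcases h' with ⟨h₁', h₂', h₃', h₄', h₅'⟩ | ⟨h₁', h₂', h₃', h₄', h₅'⟩ |
      ⟨h₁', h₂', h₃', h₄', h₅'⟩ | ⟨h₁', h₂', h₃', h₄', h₅'⟩ <;>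
    first
    | (rw [h₄] at h₄'; simp at h₄'; done)
    | (obtain rfl : k = k' := Fin.ext (by omega)
       first
       | exact absurd h₃' h₃.not_capPair
       | exact absurd h₃ h₃'.not_capPair
       | exact absurd h₃' h₃.not_cupPair
       | exact absurd h₃ h₃'.not_cupPair
       | exact Prod.ext (h₂.trans h₂'.symm) (h₃.right_unique h₃')
       | exact Prod.ext (h₂.trans h₂'.symm) (h₃.left_unique h₃'))

theorem Step.left_unique {p p' q : ℕ × ℕ} (h : D.Step p q) (h' : D.Step p' q) : p = p' := by
  rcases q with ⟨a, i⟩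
  rcases p with ⟨b, j⟩
  rcases p' with ⟨b', j'⟩
  obtain ⟨k, h⟩ := h
  obtain ⟨k', h'⟩ := h'
  simp only at h h'
  rcases h with ⟨h₁, h₂, h₃, h₄, h₅⟩ | ⟨h₁, h₂, h₃, h₄, h₅⟩ | ⟨h₁, h₂, h₃, h₄, h₅⟩ |
      ⟨h₁, h₂, h₃, h₄, h₅⟩ <;>
    rcases h' with ⟨h₁', h₂', h₃', h₄', h₅'⟩ | ⟨h₁', h₂', h₃', h₄', h₅'⟩ |
      ⟨h₁', h₂', h₃', h₄', h₅'⟩ | ⟨h₁', h₂', h₃', h₄', h₅'⟩ <;>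
    first
    | (rw [h₅] at h₅'; simp at h₅'; done)
    | (obtain rfl : k = k' := Fin.ext (by omega)
       first
       | exact absurd h₃'.symm h₃.not_capPair
       | exact absurd h₃.symm h₃'.not_capPair
       | exact absurd h₃'.symm h₃.not_cupPair
       | exact absurd h₃.symm h₃'.not_cupPair
       | exact Prod.ext (h₁.trans h₁'.symm) (h₃.symm.right_unique h₃'.symm)
       | exact Prod.ext (h₁.trans h₁'.symm) (h₃.right_unique h₃')
       | exact Prod.ext (h₁.trans h₁'.symm) (h₃.left_unique h₃'))

theorem exists_step (p : D.Point) : ∃ q : D.Point, D.Step p.coords q.coords := by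
  suffices h : ∃ a, D.Step p.coords a by
    obtain ⟨a, ha⟩ := h
    obtain ⟨d, hd⟩ : ∃ d, D.dirAt a = some d := by
      obtain ⟨k, h | h | h | h⟩ := ha <;> exact ⟨_, h.2.2.2.2⟩
    obtain ⟨q, rfl⟩ := exists_point hd
    exact ⟨q, ha⟩
  obtain ⟨d, hd⟩ := p.exists_dirAt
  rcases p with ⟨k, i⟩
  simp only [Point.coords] at *
  cases d
  -- The last line is empty, so an upward strand has a slice above it; dually, the first line is
  -- empty for downward strands.
  · have hk : k ≠ Fin.last _ := by
      rintro rfl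
      have := i.2
      simp [D.row_last] at this
    obtain ⟨k, rfl⟩ := Fin.exists_castSucc_eq.2 hk
    rw [Fin.val_castSucc] at *
    have hi : (i : ℕ) < (D.slice k).bottom.length := by rw [D.bottom_eq]; exact i.2
    rcases Slice.exists_thread_or_capPair hi with ⟨j, hj⟩ | ⟨j, hj⟩
    · rcases step_of_thread hj with h | h
      · exact ⟨_, h.1⟩
      · obtain ⟨d, h₁, h₂⟩ := hj.exists_dir
        rw [← dirAt_bottom, hd] at h₁
        rw [← dirAt_top, h.2] at h₂
        exact absurd (h₁.trans h₂.symm) (by simp)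
    · rcases step_of_capPair hj with h | h
      · exact ⟨_, h.1⟩
      · obtain ⟨d, h₁, h₂⟩ := hj.exists_dir
        rw [← dirAt_bottom, hd] at h₁
        rw [← dirAt_bottom, h.2] at h₂
        cases d <;> simp [Dir.flip] at h₁ h₂
  · have hk : k ≠ 0 := by
      rintro rfl
      have := i.2
      simp [D.row_zero] at this
    obtain ⟨k, rfl⟩ := Fin.exists_succ_eq.2 hk
    rw [Fin.val_succ] at *
    have hi : (i : ℕ) < (D.slice k).top.length := by rw [D.top_eq]; exact i.2
    rcases Slice.exists_thread_or_cupPair hi with ⟨j, hj⟩ | ⟨j, hj⟩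
    · rcases step_of_thread hj with h | h
      · obtain ⟨d, h₁, h₂⟩ := hj.exists_dir
        rw [← dirAt_bottom, h.2] at h₁
        rw [← dirAt_top, hd] at h₂
        exact absurd (h₁.trans h₂.symm) (by simp)
      · exact ⟨_, h.1⟩
    · rcases step_of_cupPair hj with h | h
      · exact ⟨_, h.1⟩
      · obtain ⟨d, h₁, h₂⟩ := hj.exists_dir
        rw [← dirAt_top, hd] at h₁
        rw [← dirAt_top, h.2] at h₂
        cases d <;> simp [Dir.flip] at h₁ h₂

instance : Finite D.Point := by unfold Point; infer_instance

/-- Predecessors are unique, so the successor map is injective, hence bijective on the finite set of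
points. -/
theorem exists_next (D : LinkDiagram) :
    ∃ σ : Equiv.Perm D.Point, ∀ p, D.Step p.coords (σ p).coords := by
  choose f hf using exists_step (D := D)
  have hi : Function.Injective f := by
    intro p q h
    apply Point.coords_injective
    have := hf p
    rw [h] at this
    exact this.left_unique (hf q)
  exact ⟨Equiv.ofBijective f (Finite.injective_iff_bijective.1 hi), hf⟩

/-- The point following a given one along the orientation of the link. -/
noncomputable def next (D : LinkDiagram) : Equiv.Perm D.Point := D.exists_next.choose

theorem step_next (p : D.Point) : D.Step p.coords (D.next p).coords := D.exists_next.choose_spec p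

theorem Step.next_eq {p q : D.Point} (h : D.Step p.coords q.coords) : D.next p = q :=
  Point.coords_injective ((step_next p).right_unique h)

theorem Slice.Thread.joined {k : Fin D.height} {i j : ℕ} (h : (D.slice k).Thread i j) :
    D.Joined (k, i) (k + 1, j) := by
  rcases h with ⟨hi, rfl⟩ | ⟨m, hm, rfl, rfl⟩ | ⟨hp, rfl, rfl⟩ | ⟨⟨b, hp⟩, ⟨rfl, rfl⟩ | ⟨rfl, rfl⟩⟩
  · exact .left k _ hi
  · exact .right k m hm
  · exact .dot k hp
  · exact .crossing_right k b hp
  · exact .crossing_left k b hp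

theorem Step.joined {p q : ℕ × ℕ} (h : D.Step p q) : D.Joined p q ∨ D.Joined q p := by
  rcases p with ⟨a, i⟩
  rcases q with ⟨b, j⟩
  obtain ⟨k, h⟩ := h
  simp only at h
  rcases h with ⟨rfl, rfl, h, -, -⟩ | ⟨rfl, rfl, h, -, -⟩ |
    ⟨rfl, rfl, ⟨⟨d, hp⟩, ⟨rfl, rfl⟩ | ⟨rfl, rfl⟩⟩, -, -⟩ |
    ⟨rfl, rfl, ⟨⟨d, hp⟩, ⟨rfl, rfl⟩ | ⟨rfl, rfl⟩⟩, -, -⟩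
  · exact .inl (Slice.Thread.joined h)
  · exact .inr (Slice.Thread.joined h)
  · exact .inl (.cap k d hp)
  · exact .inr (.cap k d hp)
  · exact .inl (.cup k d hp)
  · exact .inr (.cup k d hp)

/-- With `Step.joined`, this matches the unoriented relation defining components with the oriented
steps. -/
theorem Joined.step {p q : ℕ × ℕ} (h : D.Joined p q) : D.Step p q ∨ D.Step q p := by
  have aux : ∀ {k : Fin D.height} {i j : ℕ}, (D.slice k).Thread i j →
      D.Step (k, i) (k + 1, j) ∨ D.Step (k + 1, j) (k, i) := fun h =>
    (step_of_thread h).imp And.left And.left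
  cases h with
  | left k i hi => exact aux (.inl ⟨hi, rfl⟩)
  | right k j hj => exact aux (.inr (.inl ⟨j, hj, rfl, rfl⟩))
  | cup k d h => exact (step_of_cupPair ⟨⟨d, h⟩, .inl ⟨rfl, rfl⟩⟩).imp And.left And.left
  | cap k d h => exact (step_of_capPair ⟨⟨d, h⟩, .inl ⟨rfl, rfl⟩⟩).imp And.left And.left
  | dot k h => exact aux (.inr (.inr (.inl ⟨h, rfl, rfl⟩)))
  | crossing_right k b h => exact aux (.inr (.inr (.inr ⟨⟨b, h⟩, .inl ⟨rfl, rfl⟩⟩)))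
  | crossing_left k b h => exact aux (.inr (.inr (.inr ⟨⟨b, h⟩, .inr ⟨rfl, rfl⟩⟩)))

theorem component_next (p : D.Point) : D.component (D.next p) = D.component p :=
  (step_next p).joined.elim
    (fun h => (Quot.sound (r := fun p q : D.Point => D.Joined p.coords q.coords) h).symm)
    fun h => Quot.sound h

theorem Joined.next_eq {p q : D.Point} (h : D.Joined p.coords q.coords) :
    q = D.next p ∨ p = D.next q :=
  h.step.imp (fun h => h.next_eq.symm) fun h => h.next_eq.symm

end LinkDiagram

/-! ### The colouring rule for abelian `G` -/

/-- The position, among the bottom ends of a vertex, of the strand on which the vertex acts: the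
under-strand of a crossing. -/
def Piece.under : Piece → ℕ
  | .crossing true => 1
  | _ => 0

namespace Slice

variable {G E : Type*} [CommGroup G] [Group E] [MulDistribMulAction G E] {𝒢 : CrossedModule G E}

theorem exists_append_of_length {α : Type*} {A : List α} {l m r : ℕ} (h : A.length = l + m + r) :
    ∃ A₁ A₂ A₃, A = A₁ ++ (A₂ ++ A₃) ∧ A₁.length = l ∧ A₂.length = m ∧ A₃.length = r := by
  refine ⟨A.take l, (A.drop l).take m, (A.drop l).drop m, by simp, ?_, ?_, ?_⟩ <;> simp <;> omega

theorem rule_label_eq_one {p : Piece} {S T : List G} {e : E} (h : p.Rule 𝒢 S T e)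
    (hp : ¬ p.isVertex = true) : e = 1 := by
  cases p with
  | cup d => obtain ⟨_, -, -, h⟩ := h; exact h
  | cap d => obtain ⟨_, -, -, h⟩ := h; exact h
  | dot => simp [Piece.isVertex] at hp
  | crossing b => simp [Piece.isVertex] at hp

/-- Commutativity enters here: conjugation by the over-strand colour disappears, leaving a jump by
`∂(e)` on the under-strand. -/
theorem piece_rule_iff (p : Piece) {S T : List G} (hS : S.length = p.bottom.length)
    (hT : T.length = p.top.length) {e : E} (he : ¬ p.isVertex = true → e = 1) :
    p.Rule 𝒢 S T e ↔
      (p = .dot → T[0]? = S[0]?.map (𝒢.bd e * ·)) ∧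
      (p = .crossing true → T[0]? = S[1]?.map (𝒢.bd e * ·) ∧ T[1]? = S[0]?) ∧
      (p = .crossing false → T[1]? = S[0]?.map (𝒢.bd e * ·) ∧ T[0]? = S[1]?) ∧
      ((∃ d, p = .cap d) → S[0]? = S[1]?) ∧ ((∃ d, p = .cup d) → T[0]? = T[1]?) := by
  rcases p with d | d | _ | (_ | _)
  · obtain rfl : e = 1 := he (by simp [Piece.isVertex])
    obtain ⟨x, y, rfl⟩ := List.length_eq_two.1 hT
    obtain rfl := List.length_eq_zero_iff.1 hS
    simp [Piece.Rule]
    grind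
  · obtain rfl : e = 1 := he (by simp [Piece.isVertex])
    obtain ⟨x, y, rfl⟩ := List.length_eq_two.1 hS
    obtain rfl := List.length_eq_zero_iff.1 hT
    simp [Piece.Rule]
    grind
  · obtain ⟨x, rfl⟩ := List.length_eq_one_iff.1 hS
    obtain ⟨y, rfl⟩ := List.length_eq_one_iff.1 hT
    simp [Piece.Rule]
  · obtain ⟨x, y, rfl⟩ := List.length_eq_two.1 hS
    obtain ⟨z, w, rfl⟩ := List.length_eq_two.1 hT
    have : ∀ X Y : G, X⁻¹ * 𝒢.bd e * Y * X = 𝒢.bd e * Y := fun X Y => by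
      rw [mul_assoc X⁻¹, mul_comm, mul_inv_cancel_left]
    simp [Piece.Rule, this]
    grind
  · obtain ⟨x, y, rfl⟩ := List.length_eq_two.1 hS
    obtain ⟨z, w, rfl⟩ := List.length_eq_two.1 hT
    have : ∀ X Y : G, 𝒢.bd e * X * Y * X⁻¹ = 𝒢.bd e * Y := fun X Y => by
      rw [mul_right_comm, mul_inv_cancel_right]
    simp [Piece.Rule, this]

/-- For abelian `G` the colouring rule of a slice says that colours are constant along strands,
except that the strand on which a vertex with label `e` acts is multiplied by `∂(e)`. -/
theorem rule_iff (s : Slice) {A B : List G} (hA : A.length = s.bottom.length)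
    (hB : B.length = s.top.length) {e : E} (he : ¬ s.piece.isVertex = true → e = 1) :
    (B.take s.left.length = A.take s.left.length ∧
      B.drop (s.left.length + s.piece.top.length) =
        A.drop (s.left.length + s.piece.bottom.length) ∧
      s.piece.Rule 𝒢 ((A.drop s.left.length).take s.piece.bottom.length)
        ((B.drop s.left.length).take s.piece.top.length) e) ↔
    (∀ i j, s.Thread i j → B[j]? =
      if s.piece.isVertex = true ∧ i = s.left.length + s.piece.under then
        A[i]?.map (𝒢.bd e * ·) else A[i]?) ∧
    (∀ i j, s.CapPair i j → A[i]? = A[j]?) ∧ (∀ i j, s.CupPair i j → B[i]? = B[j]?) := by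
  simp only [bottom, top, List.length_append] at hA hB
  obtain ⟨A₁, A₂, A₃, rfl, hA₁, hA₂, hA₃⟩ := exists_append_of_length hA
  obtain ⟨B₁, B₂, B₃, rfl, hB₁, hB₂, hB₃⟩ := exists_append_of_length hB
  have hL : (B₁ = A₁) ↔ ∀ i < s.left.length, B₁[i]? = A₁[i]? := by
    refine ⟨fun h _ _ => by rw [h], fun h => List.ext_getElem? fun i => ?_⟩
    rcases lt_or_ge i s.left.length with hi | hi
    · exact h i hi
    · rw [List.getElem?_eq_none (by omega), List.getElem?_eq_none (by omega)]
  have hR : (B₃ = A₃) ↔ ∀ i < s.right.length, B₃[i]? = A₃[i]? := by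
    refine ⟨fun h _ _ => by rw [h], fun h => List.ext_getElem? fun i => ?_⟩
    rcases lt_or_ge i s.right.length with hi | hi
    · exact h i hi
    · rw [List.getElem?_eq_none (by omega), List.getElem?_eq_none (by omega)]
  have hl : ∀ {l₁ l₂ l₃ : List G}, l₁.length = s.left.length → ∀ i < s.left.length,
      (l₁ ++ (l₂ ++ l₃))[i]? = l₁[i]? := fun h i hi =>
    List.getElem?_append_left (by omega)
  have hm : ∀ {l₁ l₂ l₃ : List G}, l₁.length = s.left.length → ∀ i < l₂.length,
      (l₁ ++ (l₂ ++ l₃))[s.left.length + i]? = l₂[i]? := fun h i hi => by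
    rw [List.getElem?_append_right (by omega), h, Nat.add_sub_cancel_left,
      List.getElem?_append_left hi]
  have hr : ∀ {l₁ l₂ l₃ : List G} {n : ℕ}, l₁.length = s.left.length → l₂.length = n → ∀ i,
      (l₁ ++ (l₂ ++ l₃))[s.left.length + n + i]? = l₃[i]? := fun h h' i => by
    rw [List.getElem?_append_right (by omega), List.getElem?_append_right (by omega)]
    congr 1
    omega
  have hunder : s.piece.isVertex = true → s.piece.under < s.piece.bottom.length := by
    rcases s.piece with d | d | _ | (_ | _) <;>
      simp [Piece.isVertex, Piece.under, Piece.bottom]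
  have e₁ : List.drop s.left.length (A₁ ++ (A₂ ++ A₃)) = A₂ ++ A₃ := by rw [← hA₁]; simp
  have e₂ : List.drop s.left.length (B₁ ++ (B₂ ++ B₃)) = B₂ ++ B₃ := by rw [← hB₁]; simp
  have e₃ : List.take s.left.length (A₁ ++ (A₂ ++ A₃)) = A₁ := by rw [← hA₁]; simp
  have e₄ : List.take s.left.length (B₁ ++ (B₂ ++ B₃)) = B₁ := by rw [← hB₁]; simp
  have e₅ : List.take s.piece.bottom.length (A₂ ++ A₃) = A₂ := by rw [← hA₂]; simp
  have e₆ : List.take s.piece.top.length (B₂ ++ B₃) = B₂ := by rw [← hB₂]; simp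
  have e₇ : List.drop s.piece.bottom.length (A₂ ++ A₃) = A₃ := by rw [← hA₂]; simp
  have e₈ : List.drop s.piece.top.length (B₂ ++ B₃) = B₃ := by rw [← hB₂]; simp
  rw [← List.drop_drop, ← List.drop_drop, e₁, e₂, e₃, e₄, e₅, e₆, e₇, e₈, hL, hR,
    piece_rule_iff s.piece hA₂ hB₂ he]
  constructor
  · rintro ⟨h₁, h₂, h₃, h₄, h₅, h₆, h₇⟩
    refine ⟨?_, ?_, ?_⟩
    · rintro i j (⟨hi, rfl⟩ | ⟨m, hm', rfl, rfl⟩ | ⟨hp, rfl, rfl⟩ |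
        ⟨⟨b, hp⟩, ⟨rfl, rfl⟩ | ⟨rfl, rfl⟩⟩)
      · rw [if_neg (by omega), hl hA₁ _ hi, hl hB₁ _ hi, h₁ _ hi]
      · rw [if_neg (by rintro ⟨h, h'⟩; have := hunder h; omega), hr hA₁ hA₂, hr hB₁ hB₂, h₂ _ hm']
      · have := h₃ hp
        rw [hp] at hA₂ hB₂
        have a := hm (l₂ := A₂) (l₃ := A₃) hA₁ 0 (by simp [hA₂, Piece.bottom])
        have c := hm (l₂ := B₂) (l₃ := B₃) hB₁ 0 (by simp [hB₂, Piece.top])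
        simp only [Nat.add_zero] at a c
        rw [if_pos (by simp [hp, Piece.isVertex, Piece.under]), a, c, this]
      all_goals
        rw [hp] at hA₂ hB₂
        have a := hm (l₂ := A₂) (l₃ := A₃) hA₁ 0 (by simp [hA₂, Piece.bottom])
        have c := hm (l₂ := B₂) (l₃ := B₃) hB₁ 0 (by simp [hB₂, Piece.top])
        have a' := hm (l₂ := A₂) (l₃ := A₃) hA₁ 1 (by simp [hA₂, Piece.bottom])
        have c' := hm (l₂ := B₂) (l₃ := B₃) hB₁ 1 (by simp [hB₂, Piece.top])
        simp only [Nat.add_zero] at a c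
        cases b
        · have := h₅ hp
          simp [Piece.isVertex, Piece.under, *]
        · have := h₄ hp
          simp [Piece.isVertex, Piece.under, *]
    · rintro i j ⟨⟨d, hp⟩, h⟩
      have := h₆ ⟨d, hp⟩
      rw [hp] at hA₂
      have a := hm (l₂ := A₂) (l₃ := A₃) hA₁ 0 (by simp [hA₂, Piece.bottom])
      have a' := hm (l₂ := A₂) (l₃ := A₃) hA₁ 1 (by simp [hA₂, Piece.bottom])
      simp only [Nat.add_zero] at a
      rcases h with ⟨rfl, rfl⟩ | ⟨rfl, rfl⟩ <;> rw [a, a', this]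
    · rintro i j ⟨⟨d, hp⟩, h⟩
      have := h₇ ⟨d, hp⟩
      rw [hp] at hB₂
      have a := hm (l₂ := B₂) (l₃ := B₃) hB₁ 0 (by simp [hB₂, Piece.top])
      have a' := hm (l₂ := B₂) (l₃ := B₃) hB₁ 1 (by simp [hB₂, Piece.top])
      simp only [Nat.add_zero] at a
      rcases h with ⟨rfl, rfl⟩ | ⟨rfl, rfl⟩ <;> rw [a, a', this]
  · rintro ⟨h₁, h₂, h₃⟩
    refine ⟨fun i hi => ?_, fun m hm' => ?_, fun hp => ?_, fun hp => ?_, fun hp => ?_, ?_, ?_⟩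
    · have := h₁ i i (.inl ⟨hi, rfl⟩)
      rwa [if_neg (by omega), hl hA₁ _ hi, hl hB₁ _ hi] at this
    · have := h₁ _ _ (.inr (.inl ⟨m, hm', rfl, rfl⟩))
      rwa [if_neg (by rintro ⟨h, h'⟩; have := hunder h; omega), hr hA₁ hA₂, hr hB₁ hB₂] at this
    · have := h₁ _ _ (.inr (.inr (.inl ⟨hp, rfl, rfl⟩)))
      rw [hp] at hA₂ hB₂
      have a := hm (l₂ := A₂) (l₃ := A₃) hA₁ 0 (by simp [hA₂, Piece.bottom])
      have c := hm (l₂ := B₂) (l₃ := B₃) hB₁ 0 (by simp [hB₂, Piece.top])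
      simp only [Nat.add_zero] at a c
      rwa [if_pos (by simp [hp, Piece.isVertex, Piece.under]), a, c] at this
    iterate 2
      have := h₁ _ _ (.inr (.inr (.inr ⟨⟨_, hp⟩, .inl ⟨rfl, rfl⟩⟩)))
      have := h₁ _ _ (.inr (.inr (.inr ⟨⟨_, hp⟩, .inr ⟨rfl, rfl⟩⟩)))
      rw [hp] at hA₂ hB₂
      have a := hm (l₂ := A₂) (l₃ := A₃) hA₁ 0 (by simp [hA₂, Piece.bottom])
      have c := hm (l₂ := B₂) (l₃ := B₃) hB₁ 0 (by simp [hB₂, Piece.top])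
      have a' := hm (l₂ := A₂) (l₃ := A₃) hA₁ 1 (by simp [hA₂, Piece.bottom])
      have c' := hm (l₂ := B₂) (l₃ := B₃) hB₁ 1 (by simp [hB₂, Piece.top])
      simp only [Nat.add_zero] at a c
      simp_all [Piece.isVertex, Piece.under]
    · rintro ⟨d, hp⟩
      have := h₂ _ _ ⟨⟨d, hp⟩, .inl ⟨rfl, rfl⟩⟩
      rw [hp] at hA₂
      have a := hm (l₂ := A₂) (l₃ := A₃) hA₁ 0 (by simp [hA₂, Piece.bottom])
      have a' := hm (l₂ := A₂) (l₃ := A₃) hA₁ 1 (by simp [hA₂, Piece.bottom])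
      simp only [Nat.add_zero] at a
      rwa [a, a'] at this
    · rintro ⟨d, hp⟩
      have := h₃ _ _ ⟨⟨d, hp⟩, .inl ⟨rfl, rfl⟩⟩
      rw [hp] at hB₂
      have a := hm (l₂ := B₂) (l₃ := B₃) hB₁ 0 (by simp [hB₂, Piece.top])
      have a' := hm (l₂ := B₂) (l₃ := B₃) hB₁ 1 (by simp [hB₂, Piece.top])
      simp only [Nat.add_zero] at a
      rwa [a, a'] at this

end Slice

/-! ### Colourings as marked functions, and their number -/

namespace LinkDiagram

variable {D : LinkDiagram}

/-- The slices which contain a vertex of the underlying graph. -/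
abbrev Vertex (D : LinkDiagram) : Type := {k : Fin D.height // (D.slice k).piece.isVertex = true}

theorem dirAt_under (v : D.Vertex) :
    D.dirAt (v.1, (D.slice v.1).left.length + (D.slice v.1).piece.under) = some .up := by
  rw [dirAt_bottom]
  obtain ⟨k, hk⟩ := v
  revert hk
  simp only [Slice.bottom]
  rcases (D.slice k).piece with d | d | _ | (_ | _) <;>
    simp [Piece.isVertex, Piece.under, Piece.bottom]

/-- The point just below a vertex on the strand on which the vertex acts. -/
noncomputable def tail (v : D.Vertex) : D.Point := (exists_point (dirAt_under v)).choose

theorem tail_coords (v : D.Vertex) : (tail v).coords =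
    ((v.1 : ℕ), (D.slice v.1).left.length + (D.slice v.1).piece.under) :=
  (exists_point (dirAt_under v)).choose_spec

theorem dirAt_tail (v : D.Vertex) : D.dirAt (tail v).coords = some .up := by
  rw [tail_coords, dirAt_under]

theorem tail_injective : Function.Injective (tail (D := D)) := by
  intro v w h
  have := congrArg Point.coords h
  rw [tail_coords, tail_coords, Prod.mk.injEq] at this
  exact Subtype.ext (Fin.ext this.1)

theorem eq_tail_of_coords {p : D.Point} {k : Fin D.height} {i : ℕ} (hp : p.coords = ((k : ℕ), i))
    (h : (D.slice k).piece.isVertex = true ∧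
      i = (D.slice k).left.length + (D.slice k).piece.under) : p = tail ⟨k, h.1⟩ :=
  Point.coords_injective (by rw [hp, tail_coords]; exact Prod.ext rfl h.2)

theorem of_coords_tail {v : D.Vertex} {k : Fin D.height} {i : ℕ}
    (h : (tail v).coords = ((k : ℕ), i)) : v.1 = k ∧ (D.slice k).piece.isVertex = true ∧
      i = (D.slice k).left.length + (D.slice k).piece.under := by
  rw [tail_coords, Prod.mk.injEq] at h
  obtain ⟨v, hv⟩ := v
  obtain rfl : v = k := Fin.ext h.1
  exact ⟨rfl, hv, h.2.symm⟩

theorem getElem?_of_coords {α : Type*} {col : Fin (D.height + 1) → List α} {x : D.Point → α}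
    (hx : ∀ k (i : Fin (D.row k).length), (col k)[(i : ℕ)]? = some (x ⟨k, i⟩)) {p : D.Point}
    {k : Fin (D.height + 1)} {i : ℕ} (hp : p.coords = ((k : ℕ), i)) : (col k)[i]? = some (x p) := by
  rcases p with ⟨k', i'⟩
  simp only [Point.coords, Prod.mk.injEq] at hp
  obtain ⟨h₁, rfl⟩ := hp
  obtain rfl := Fin.ext h₁
  exact hx _ _

variable {G E : Type*} [CommGroup G] [Group E] [MulDistribMulAction G E] {𝒢 : CrossedModule G E}

/-- Every thread, maximum and minimum is one step of `next`, in one direction or the other, so the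
local conditions are exactly conditions on `next`. Strands at a vertex point upwards, so a jump
always occurs in passing from the tail to its successor. -/
theorem colouring_iff {col : Fin (D.height + 1) → List G} {x : D.Point → G}
    (hcol : ∀ k, (col k).length = (D.row k).length)
    (hx : ∀ k (i : Fin (D.row k).length), (col k)[(i : ℕ)]? = some (x ⟨k, i⟩)) {e : Fin D.height → E}
    (he : ∀ k, ¬ (D.slice k).piece.isVertex = true → e k = 1) :
    (∀ k, (col k.succ).take (D.slice k).left.length =
        (col k.castSucc).take (D.slice k).left.length ∧
      (col k.succ).drop ((D.slice k).left.length + (D.slice k).piece.top.length) =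
        (col k.castSucc).drop ((D.slice k).left.length + (D.slice k).piece.bottom.length) ∧
      (D.slice k).piece.Rule 𝒢
        (((col k.castSucc).drop (D.slice k).left.length).take (D.slice k).piece.bottom.length)
        (((col k.succ).drop (D.slice k).left.length).take (D.slice k).piece.top.length) (e k)) ↔
    (∀ p, p ∉ Set.range tail → x (D.next p) = x p) ∧
      ∀ v : D.Vertex, x (D.next (tail v)) = 𝒢.bd (e v.1) * x (tail v) := by
  have hb : ∀ {p : D.Point} {k : Fin D.height} {i : ℕ}, p.coords = ((k : ℕ), i) →
      (col k.castSucc)[i]? = some (x p) := fun hp => getElem?_of_coords hx hp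
  have ht : ∀ {p : D.Point} {k : Fin D.height} {i : ℕ}, p.coords = ((k : ℕ) + 1, i) →
      (col k.succ)[i]? = some (x p) := fun hp => getElem?_of_coords hx (by rw [hp]; rfl)
  rw [forall_congr' fun k => Slice.rule_iff (D.slice k) (by rw [hcol, D.bottom_eq])
    (by rw [hcol, D.top_eq]) (he k)]
  constructor
  · intro h
    refine ⟨fun p hp => ?_, fun v => ?_⟩
    · obtain ⟨k, ⟨h₁, h₂, h₃, h₄, h₅⟩ | ⟨h₁, h₂, h₃, h₄, h₅⟩ | ⟨h₁, h₂, h₃, h₄, h₅⟩ |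
        ⟨h₁, h₂, h₃, h₄, h₅⟩⟩ := step_next p
      · have := (h k).1 _ _ h₃
        rw [if_neg fun h' => hp ⟨_, (eq_tail_of_coords (Prod.ext h₁ rfl) h').symm⟩,
          hb (Prod.ext h₁ rfl), ht (Prod.ext h₂ rfl)] at this
        exact Option.some.inj this
      · have := (h k).1 _ _ h₃
        rw [if_neg fun h' => ?_, ht (Prod.ext h₁ rfl), hb (Prod.ext h₂ rfl)] at this
        · exact (Option.some.inj this).symm
        -- The strand runs downwards here, whereas tails lie on upward strands.
        · rw [eq_tail_of_coords (Prod.ext h₂ rfl) h', dirAt_tail] at h₅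
          simp at h₅
      · have := (h k).2.1 _ _ h₃
        rw [hb (Prod.ext h₁ rfl), hb (Prod.ext h₂ rfl)] at this
        exact (Option.some.inj this).symm
      · have := (h k).2.2 _ _ h₃
        rw [ht (Prod.ext h₁ rfl), ht (Prod.ext h₂ rfl)] at this
        exact (Option.some.inj this).symm
    · have hd := dirAt_tail v
      obtain ⟨k, ⟨h₁, h₂, h₃, h₄, h₅⟩ | ⟨h₁, h₂, h₃, h₄, h₅⟩ | ⟨h₁, h₂, h₃, h₄, h₅⟩ |
        ⟨h₁, h₂, h₃, h₄, h₅⟩⟩ := step_next (tail v)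
      · obtain ⟨rfl, h'⟩ := of_coords_tail (Prod.ext h₁ rfl)
        have := (h _).1 _ _ h₃
        rw [if_pos h', hb (Prod.ext h₁ rfl), ht (Prod.ext h₂ rfl)] at this
        exact Option.some.inj this
      · rw [hd] at h₄; simp at h₄
      · obtain ⟨-, h', -⟩ := of_coords_tail (Prod.ext h₁ rfl)
        obtain ⟨⟨d, hd⟩, -⟩ := h₃
        rw [hd] at h'
        simp [Piece.isVertex] at h'
      · rw [hd] at h₄; simp at h₄
  · rintro ⟨h, hv⟩ k
    refine ⟨fun i j hT => ?_, fun i j hC => ?_, fun i j hC => ?_⟩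
    · obtain ⟨d, h₁, h₂⟩ := hT.exists_dir
      rw [← dirAt_bottom] at h₁
      rw [← dirAt_top] at h₂
      obtain ⟨p, hp⟩ := exists_point h₁
      obtain ⟨q, hq⟩ := exists_point h₂
      rw [hb hp, ht hq]
      rcases step_of_thread hT with ⟨hs, hd⟩ | ⟨hs, hd⟩
      · have hn : D.next p = q := Step.next_eq (by rwa [hp, hq])
        split_ifs with hc
        · obtain rfl := eq_tail_of_coords hp hc
          simp [← hn, hv]
        · rw [← hn, h p]
          rintro ⟨v, rfl⟩
          exact hc (of_coords_tail hp).2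
      · have hn : D.next q = p := Step.next_eq (by rwa [hp, hq])
        rw [h₂] at hd
        rw [hd] at h₁ h₂
        rw [if_neg, ← hn, h q]
        · rintro ⟨v, rfl⟩
          rw [← hq, dirAt_tail] at h₂
          simp at h₂
        · intro hc
          rw [← hp, eq_tail_of_coords hp hc, dirAt_tail] at h₁
          simp at h₁
    · obtain ⟨d, h₁, h₂⟩ := hC.exists_dir
      rw [← dirAt_bottom] at h₁ h₂
      obtain ⟨p, hp⟩ := exists_point h₁
      obtain ⟨q, hq⟩ := exists_point h₂
      rw [hb hp, hb hq]
      have hnv : ¬ (D.slice k).piece.isVertex = true := by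
        obtain ⟨⟨d, hd⟩, -⟩ := hC
        simp [hd, Piece.isVertex]
      rcases step_of_capPair hC with ⟨hs, -⟩ | ⟨hs, -⟩
      · have hn : D.next p = q := Step.next_eq (by rwa [hp, hq])
        rw [← hn, h p]
        rintro ⟨v, rfl⟩
        exact hnv (of_coords_tail hp).2.1
      · have hn : D.next q = p := Step.next_eq (by rwa [hp, hq])
        rw [← hn, h q]
        rintro ⟨v, rfl⟩
        exact hnv (of_coords_tail hq).2.1
    · obtain ⟨d, h₁, h₂⟩ := hC.exists_dir
      rw [← dirAt_top] at h₁ h₂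
      obtain ⟨p, hp⟩ := exists_point h₁
      obtain ⟨q, hq⟩ := exists_point h₂
      rw [ht hp, ht hq]
      rcases step_of_cupPair hC with ⟨hs, hd⟩ | ⟨hs, hd⟩
      · have hn : D.next p = q := Step.next_eq (by rwa [hp, hq])
        rw [← hn, h p]
        rintro ⟨v, rfl⟩
        rw [← hp, dirAt_tail] at hd
        simp at hd
      · have hn : D.next q = p := Step.next_eq (by rwa [hp, hq])
        rw [← hn, h q]
        rintro ⟨v, rfl⟩
        rw [← hq, dirAt_tail] at hd
        simp at hd

/-- For abelian `G`, a colouring is a function on the points of the diagram which is constant along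
the link except that it is multiplied by `∂(e)` where a vertex labelled `e` acts. -/
noncomputable def colouringEquiv (𝒢 : CrossedModule G E) (D : LinkDiagram) : Colouring 𝒢 D ≃
    {z : (D.Point → G) × (D.Vertex → E) //
      (∀ p, p ∉ Set.range tail → z.1 (D.next p) = z.1 p) ∧
        ∀ v, z.1 (D.next (tail v)) = 𝒢.bd (z.2 v) * z.1 (tail v)} where
  toFun c := ⟨(fun p => (c.colour p.1)[(p.2 : ℕ)]'(by rw [c.length_eq]; exact p.2.2),
      fun v => c.label v.1),
    (colouring_iff c.length_eq (fun k i => by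
        rw [List.getElem?_eq_getElem (by rw [c.length_eq]; exact i.2)])
      (fun k => Slice.rule_label_eq_one (c.rule k))).1
      fun k => ⟨c.left_eq k, c.right_eq k, c.rule k⟩⟩
  invFun z :=
    have h := (colouring_iff (𝒢 := 𝒢) (D := D) (col := fun k => List.ofFn fun i => z.1.1 ⟨k, i⟩)
      (x := z.1.1) (fun k => by simp) (fun k i => by simp)
      -- The value `1` off the vertices is the one forced by the rule at maxima and minima.
      (e := fun k => if h : (D.slice k).piece.isVertex = true then z.1.2 ⟨k, h⟩ else 1)
      (fun k h => dif_neg h)).2 ⟨z.2.1, fun v => by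
        rw [dif_pos v.2]
        exact z.2.2 v⟩
    { colour := fun k => List.ofFn fun i => z.1.1 ⟨k, i⟩
      label := fun k => if h : (D.slice k).piece.isVertex = true then z.1.2 ⟨k, h⟩ else 1
      length_eq := fun k => by simp
      left_eq := fun k => (h k).1
      right_eq := fun k => (h k).2.1
      rule := fun k => (h k).2.2 }
  left_inv c := by
    apply Colouring.ext
    · funext k
      apply List.ext_getElem
      · simp [c.length_eq]
      · simp
    · funext k
      by_cases h : (D.slice k).piece.isVertex = true
      · exact dif_pos h
      · exact (dif_neg h).trans (Slice.rule_label_eq_one (c.rule k) h).symm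
  right_inv z := by
    apply Subtype.ext
    apply Prod.ext
    · funext p
      simp only [List.getElem_ofFn]
      rfl
    · funext v
      exact dif_pos v.2

theorem card_colouring [Finite G] [Finite E] (𝒢 : CrossedModule G E) (hD : D.IsDotted) :
    Nat.card (Colouring 𝒢 D) =
      Nat.card (G ⧸ 𝒢.bd.range) ^ D.numComponents * Nat.card E ^ D.numVertices := by
  rw [Nat.card_congr (colouringEquiv 𝒢 D)]
  refine card_marked_labellings D.next tail tail_injective _ (fun p q h => Joined.next_eq h)
    component_next (fun x => ?_) 𝒢.bd
  obtain ⟨k, q, hk, hq, rfl⟩ := hD x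
  have hv : (D.slice k).piece.isVertex = true := by simp [hk, Piece.isVertex]
  refine ⟨⟨k, hv⟩, ?_⟩
  -- The only bottom end of a dot has position `0`, so the point below the dot is a tail: the dots
  -- put a mark on every component.
  rw [← eq_tail_of_coords (p := q) hq ⟨hv, by simp [hk, Piece.under]⟩]
  rfl

end LinkDiagram

/-! ### Evaluations and the kernel of the boundary map -/

namespace CrossedModule

variable {G E : Type*} [CommGroup G] [Group E] [MulDistribMulAction G E] (𝒢 : CrossedModule G E)

/-- By the Peiffer identity, conjugation by `z` is the action of `∂(z) = 1`. -/
theorem commute_of_mem_ker {z : E} (hz : z ∈ 𝒢.bd.ker) (e : E) : z * e = e * z := by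
  have := 𝒢.peiffer z e
  rw [MonoidHom.mem_ker.1 hz, one_smul] at this
  exact (eq_mul_inv_iff_mul_eq.1 this).symm

theorem bd_smul_of_comm (X : G) (e : E) : 𝒢.bd (X • e) = 𝒢.bd e := by
  rw [𝒢.bd_smul, mul_comm X, mul_inv_cancel_right]

theorem smul_mem_ker (X : G) {z : E} (hz : z ∈ 𝒢.bd.ker) : X • z ∈ 𝒢.bd.ker := by
  rw [MonoidHom.mem_ker, bd_smul_of_comm]
  exact hz

end CrossedModule

theorem CatMor.foldl_comp_label {G E : Type*} [Group E] (l : List (CatMor G E))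
    (f : CatMor G E) :
    (l.foldl CatMor.comp f).label = (l.map CatMor.label).reverse.prod * f.label := by
  induction l generalizing f with
  | nil => simp
  | cons g l ih => simp [ih, CatMor.comp, mul_assoc]

theorem prod_reverse_ofFn_update {E : Type*} [Group E] {n : ℕ} (f : Fin n → E) (k : Fin n) {z : E}
    (hz : ∀ e, z * e = e * z) :
    (List.ofFn (Function.update f k (z * f k))).reverse.prod =
      z * (List.ofFn f).reverse.prod := by
  induction n with
  | zero => exact k.elim0
  | succ n ih =>
    rw [List.ofFn_succ, List.ofFn_succ, List.reverse_cons, List.reverse_cons, List.prod_append,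
      List.prod_append, List.prod_singleton, List.prod_singleton]
    induction k using Fin.cases with
    | zero => simp [hz, mul_assoc, Fin.succ_ne_zero]
    | succ k =>
      rw [← mul_assoc, ← ih (fun i => f i.succ) k, Function.update_of_ne (Fin.succ_ne_zero k).symm]
      congr 4
      funext i
      by_cases h : i = k
      · subst h; simp
      · rw [Function.update_of_ne h, Function.update_of_ne (by simpa using h)]

/-- A telescoping product; the reversal matches the order of composition, where later arrows
multiply on the left. -/
theorem map_prod_reverse_ofFn {G E : Type*} [CommGroup G] [Group E] (f : E →* G) {n : ℕ}
    (e : Fin n → E) (g : Fin (n + 1) → G) (h : ∀ k, g k.succ = f (e k) * g k.castSucc) :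
    g (Fin.last n) = f (List.ofFn e).reverse.prod * g 0 := by
  induction n with
  | zero => simp
  | succ n ih =>
    have h₁ := ih (fun k => e k.succ) (fun k => g k.succ) fun k => h k.succ
    have h₂ := h 0
    simp only [Fin.succ_last, Fin.succ_zero_eq_one, Fin.castSucc_zero] at h₁ h₂
    rw [List.ofFn_succ, List.reverse_cons, List.prod_append, List.prod_singleton, map_mul, mul_assoc,
      ← h₂, ← h₁]

theorem rowObject_append {G : Type*} [Group G] {w₁ w₂ : List Dir} {c₁ c₂ : List G}
    (h : w₁.length = c₁.length) :
    rowObject (w₁ ++ w₂) (c₁ ++ c₂) = rowObject w₁ c₁ * rowObject w₂ c₂ := by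
  rw [rowObject, List.zipWith_append h, List.prod_append]
  rfl

theorem Piece.Rule.rowObject_top {G E : Type*} [CommGroup G] [Group E] [MulDistribMulAction G E]
    {𝒢 : CrossedModule G E} {p : Piece} {S T : List G} {e : E} (h : p.Rule 𝒢 S T e) :
    rowObject p.top T = 𝒢.bd e * rowObject p.bottom S := by
  rcases p with d | d | _ | (_ | _)
  · obtain ⟨X, rfl, rfl, rfl⟩ := h
    cases d <;> simp [rowObject, Piece.top, Piece.bottom, Dir.object, Dir.flip]
  · obtain ⟨X, rfl, rfl, rfl⟩ := h
    cases d <;> simp [rowObject, Piece.top, Piece.bottom, Dir.object, Dir.flip]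
  · obtain ⟨X, rfl, rfl⟩ := h
    simp [rowObject, Piece.top, Piece.bottom, Dir.object]
  · obtain ⟨X, Y, rfl, rfl⟩ := h
    simp [rowObject, Piece.top, Piece.bottom, Dir.object, mul_assoc]
  · obtain ⟨X, Y, rfl, rfl⟩ := h
    simp [rowObject, Piece.top, Piece.bottom, Dir.object, mul_assoc, mul_comm Y]

theorem Piece.Rule.mul_label {G E : Type*} [Group G] [Group E] [MulDistribMulAction G E]
    {𝒢 : CrossedModule G E} {p : Piece} (hp : p.isVertex = true) {S T : List G} {e z : E}
    (h : p.Rule 𝒢 S T e) (hz : z ∈ 𝒢.bd.ker) : p.Rule 𝒢 S T (z * e) := by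
  have : 𝒢.bd (z * e) = 𝒢.bd e := by rw [map_mul, MonoidHom.mem_ker.1 hz, one_mul]
  rcases p with d | d | _ | (_ | _)
  · simp [Piece.isVertex] at hp
  · simp [Piece.isVertex] at hp
  all_goals
    simp only [Piece.Rule] at h ⊢
    rwa [this]

namespace LinkDiagram.Colouring

variable {G E : Type*} [CommGroup G] [Group E] [MulDistribMulAction G E] {𝒢 : CrossedModule G E}
  {D : LinkDiagram}

/-- The object to the left of the piece in the `k`-th slice. -/
def leftObject (c : Colouring 𝒢 D) (k : Fin D.height) : G :=
  rowObject (D.slice k).left ((c.colour k.castSucc).take (D.slice k).left.length)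

theorem sliceMor_label (c : Colouring 𝒢 D) (k : Fin D.height) :
    (c.sliceMor k).label = c.leftObject k • c.label k := by
  simp [sliceMor, CatMor.tensor, CatMor.ident, leftObject]

theorem eval_label (c : Colouring 𝒢 D) :
    c.eval.label = (List.ofFn fun k => c.leftObject k • c.label k).reverse.prod := by
  rw [eval, CatMor.foldl_comp_label, List.map_ofFn]
  simp only [CatMor.ident, mul_one]
  congr 3
  funext k
  exact c.sliceMor_label k

theorem rowObject_succ (c : Colouring 𝒢 D) (k : Fin D.height) :
    rowObject (D.row k.succ) (c.colour k.succ) =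
      𝒢.bd (c.label k) * rowObject (D.row k.castSucc) (c.colour k.castSucc) := by
  have h₁ := c.left_eq k
  have h₂ := c.right_eq k
  have h₃ := c.rule k
  have hA := c.length_eq k.castSucc
  have hB := c.length_eq k.succ
  rw [← D.bottom_eq] at hA ⊢
  rw [← D.top_eq] at hB ⊢
  generalize c.colour k.succ = B at *
  generalize c.colour k.castSucc = A at *
  generalize D.slice k = s at *
  have split : ∀ (l : List G) (m n : ℕ), l = (l.take m ++ (l.drop m).take n) ++ l.drop (m + n) := by
    intro l m n
    rw [← List.drop_drop, List.append_assoc, List.take_append_drop, List.take_append_drop]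
  simp only [Slice.top, Slice.bottom, List.length_append] at hA hB
  conv_lhs => rw [split B s.left.length s.piece.top.length]
  conv_rhs => rw [split A s.left.length s.piece.bottom.length]
  rw [Slice.top, Slice.bottom, rowObject_append (by simp; omega), rowObject_append (by simp; omega),
    rowObject_append (by simp; omega), rowObject_append (by simp; omega), h₁, h₂, h₃.rowObject_top]
  -- The factor `∂(e)` moves past the object on its left because `G` is abelian.
  ac_rfl

/-- The boundaries of the slices telescope from the bottom row to the top row. Both rows are empty,
so both objects are `1`. -/
theorem eval_label_mem_ker (c : Colouring 𝒢 D) : c.eval.label ∈ 𝒢.bd.ker := by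
  have := map_prod_reverse_ofFn 𝒢.bd (fun k => c.leftObject k • c.label k)
    (fun k => rowObject (D.row k) (c.colour k))
    (fun k => by rw [c.rowObject_succ, 𝒢.bd_smul_of_comm])
  rw [← eval_label, D.row_zero, D.row_last] at this
  simpa [rowObject] using this.symm

/-- Multiply the label of a vertex by an element of `ker ∂`. -/
def shift (c : Colouring 𝒢 D) (v : D.Vertex) (z : 𝒢.bd.ker) : Colouring 𝒢 D where
  colour := c.colour
  label := Function.update c.label v.1 (z * c.label v.1)
  length_eq := c.length_eq
  left_eq := c.left_eq
  right_eq := c.right_eq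
  rule k := by
    by_cases h : k = v.1
    · subst h
      rw [Function.update_self]
      exact (c.rule v.1).mul_label v.2 z.2
    · rw [Function.update_of_ne h]
      exact c.rule k

theorem leftObject_shift (c : Colouring 𝒢 D) (v : D.Vertex) (z : 𝒢.bd.ker) (k : Fin D.height) :
    (c.shift v z).leftObject k = c.leftObject k := rfl

theorem shift_shift (c : Colouring 𝒢 D) (v : D.Vertex) (z w : 𝒢.bd.ker) :
    (c.shift v z).shift v w = c.shift v (w * z) :=
  Colouring.ext rfl (by simp [shift, mul_assoc])

theorem shift_one (c : Colouring 𝒢 D) (v : D.Vertex) : c.shift v 1 = c :=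
  Colouring.ext rfl (by simp [shift])

/-- The inserted factor is acted on by the object to the left of the vertex. It stays in `ker ∂`,
hence is central and can be pulled out of the product. -/
theorem eval_shift (c : Colouring 𝒢 D) (v : D.Vertex) (z : 𝒢.bd.ker) :
    (c.shift v z).eval.label = c.leftObject v.1 • (z : E) * c.eval.label := by
  rw [eval_label, eval_label, ← prod_reverse_ofFn_update _ v.1
    (𝒢.commute_of_mem_ker (𝒢.smul_mem_ker _ z.2))]
  congr 3
  funext k
  rw [leftObject_shift]
  by_cases h : k = v.1
  · subst h
    simp [shift]
  · simp [shift, Function.update_of_ne h]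

/-- The evaluations of colourings are equidistributed in `ker ∂` as soon as there is a vertex. -/
def equivFlat (𝒢 : CrossedModule G E) (v : D.Vertex) :
    Colouring 𝒢 D ≃ {c : Colouring 𝒢 D // c.IsFlat} × 𝒢.bd.ker where
  -- Acting by the inverse of the left object cancels the twist in `eval_shift`, so this shift
  -- brings the evaluation to `1`; the old evaluation is kept as the second component.
  toFun c := (⟨c.shift v ⟨(c.leftObject v.1)⁻¹ • c.eval.label⁻¹,
      𝒢.smul_mem_ker _ (inv_mem c.eval_label_mem_ker)⟩, by simp [IsFlat, eval_shift]⟩,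
    ⟨c.eval.label, c.eval_label_mem_ker⟩)
  invFun x := x.1.1.shift v ⟨(x.1.1.leftObject v.1)⁻¹ • (x.2 : E), 𝒢.smul_mem_ker _ x.2.2⟩
  left_inv c := by
    simp only [leftObject_shift, shift_shift]
    convert c.shift_one v
    simp
  right_inv x := by
    obtain ⟨⟨c, hc⟩, z⟩ := x
    have hev : (c.shift v ⟨(c.leftObject v.1)⁻¹ • (z : E), 𝒢.smul_mem_ker _ z.2⟩).eval.label = z := by
      rw [eval_shift, hc]
      simp
    refine Prod.ext (Subtype.ext ?_) (Subtype.ext hev)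
    simp only [leftObject_shift, shift_shift, hev]
    convert c.shift_one v
    simp

end LinkDiagram.Colouring

/-! ### The value of the state sum and its independence of crossings -/

namespace LinkDiagram

variable {G E : Type*} [CommGroup G] [Group E] [MulDistribMulAction G E] {D : LinkDiagram}

theorem IsDotted.nonempty_vertex (hD : D.IsDotted) (p : D.Point) : Nonempty D.Vertex := by
  obtain ⟨k, -, hk, -⟩ := hD (D.component p)
  exact ⟨⟨k, by simp [hk, Piece.isVertex]⟩⟩

instance : Finite D.Component := Quot.finite _

theorem numComponents_ne_zero_iff : D.numComponents ≠ 0 ↔ Nonempty D.Point := by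
  rw [numComponents, Nat.card_ne_zero]
  exact ⟨fun ⟨⟨x⟩, _⟩ => ⟨x.exists_rep.choose⟩, fun ⟨p⟩ => ⟨⟨D.component p⟩, inferInstance⟩⟩

/-- Every elementary piece has at least one end, so any slice puts a point on one of its two
bounding lines. -/
theorem height_eq_zero (h : IsEmpty D.Point) : D.height = 0 := by
  by_contra h0
  have hrow : ∀ k, D.row k = [] := fun k => List.eq_nil_iff_length_eq_zero.2 <| by
    by_contra hk
    exact h.elim ⟨k, ⟨0, Nat.pos_of_ne_zero hk⟩⟩
  let k : Fin D.height := ⟨0, Nat.pos_of_ne_zero h0⟩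
  have hb := D.bottom_eq k
  have ht := D.top_eq k
  rw [hrow] at hb ht
  simp only [Slice.bottom, Slice.top, List.append_eq_nil_iff] at hb ht
  revert hb ht
  rcases (D.slice k).piece with d | d | _ | b <;> simp [Piece.bottom, Piece.top]

/-- For abelian `G` the state sum is
`#(G / ∂(E)) ^ #{components} / #ker ∂` if the link is not empty. -/
theorem stateSum_eq [Finite G] [Finite E] (𝒢 : CrossedModule G E) (hD : D.IsDotted) :
    D.stateSum 𝒢 = (Nat.card (G ⧸ 𝒢.bd.range) : ℚ) ^ D.numComponents /
      if D.numComponents = 0 then 1 else (Nat.card 𝒢.bd.ker : ℚ) := by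
  have hc := card_colouring 𝒢 hD
  have hE : (Nat.card E : ℚ) ≠ 0 := Nat.cast_ne_zero.2 Nat.card_pos.ne'
  rw [stateSum]
  split_ifs with h
  -- The empty link has no vertex at which to shift, and the evaluation is an empty product: every
  -- colouring is flat and no factor `#ker ∂` appears.
  · have hP : IsEmpty D.Point := by
      rw [← not_nonempty_iff, ← numComponents_ne_zero_iff]
      exact not_not.2 h
    have hh := height_eq_zero hP
    have hflat : ∀ c : Colouring 𝒢 D, c.IsFlat := fun c => by
      have : IsEmpty (Fin D.height) := by rw [hh]; infer_instance
      have hn : ∀ {n : ℕ} (f : Fin n → E), n = 0 → (List.ofFn f).reverse.prod = 1 := by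
        rintro n f rfl; simp
      rw [Colouring.IsFlat, Colouring.eval_label, hn _ hh]
    rw [Nat.card_congr (Equiv.subtypeUnivEquiv hflat), hc]
    push_cast
    rw [mul_div_assoc, div_self (pow_ne_zero _ hE), mul_one, div_one]
  -- A nonempty link carries a dot, and any one vertex suffices for the equidistribution of
  -- evaluations.
  · obtain ⟨p⟩ := numComponents_ne_zero_iff.1 h
    obtain ⟨v⟩ := hD.nonempty_vertex p
    rw [Nat.card_congr (Colouring.equivFlat 𝒢 v), Nat.card_prod] at hc
    have hK : (Nat.card 𝒢.bd.ker : ℚ) ≠ 0 := Nat.cast_ne_zero.2 Nat.card_pos.ne'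
    rw [div_eq_div_iff (pow_ne_zero _ hE) hK]
    exact_mod_cast hc

/-- Strands go straight through a crossing whichever of them passes over. The converse follows
because switching twice restores the diagram. -/
theorem joined_changeCrossings_of_joined (D : LinkDiagram) (f : Fin D.height → Bool)
    {p q : ℕ × ℕ} (h : D.Joined p q) : (D.changeCrossings f).Joined p q := by
  have hb : ∀ k : Fin D.height, (D.slice k).piece.bottom =
      (if f k then (D.slice k).piece.switch else (D.slice k).piece).bottom := by
    intro k
    cases f k <;> rcases (D.slice k).piece with d | d | _ | b <;> rfl
  have ht : ∀ k : Fin D.height, (D.slice k).piece.top =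
      (if f k then (D.slice k).piece.switch else (D.slice k).piece).top := by
    intro k
    cases f k <;> rcases (D.slice k).piece with d | d | _ | b <;> rfl
  have hp : ∀ (k : Fin D.height) (p p' : Piece), (D.slice k).piece = p →
      (if f k then p.switch else p) = p' → ((D.changeCrossings f).slice k).piece = p' := by
    rintro k p p' rfl h
    exact h
  cases h with
  | left k i hi => exact Joined.left (D := D.changeCrossings f) k i hi
  | right k j hj =>
    rw [hb, ht]
    exact Joined.right (D := D.changeCrossings f) k j hj
  | cup k d h =>
    exact Joined.cup (D := D.changeCrossings f) k d (hp k _ _ h (by simp [Piece.switch]))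
  | cap k d h =>
    exact Joined.cap (D := D.changeCrossings f) k d (hp k _ _ h (by simp [Piece.switch]))
  | dot k h =>
    exact Joined.dot (D := D.changeCrossings f) k (hp k _ _ h (by simp [Piece.switch]))
  | crossing_right k b h =>
    exact Joined.crossing_right (D := D.changeCrossings f) k (if f k then !b else b)
      (hp k _ _ h (by cases f k <;> rfl))
  | crossing_left k b h =>
    exact Joined.crossing_left (D := D.changeCrossings f) k (if f k then !b else b)
      (hp k _ _ h (by cases f k <;> rfl))

theorem changeCrossings_changeCrossings (D : LinkDiagram) (f : Fin D.height → Bool) :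
    (D.changeCrossings f).changeCrossings f = D := by
  rcases D with ⟨h, row, slice, h₁, h₂, h₃, h₄⟩
  simp only [changeCrossings, LinkDiagram.mk.injEq, heq_eq_eq, true_and]
  funext k
  have : ∀ p : Piece, p.switch.switch = p := by
    rintro (d | d | _ | b) <;> simp [Piece.switch]
  cases hf : f k <;> simp [this]

theorem joined_changeCrossings_iff (D : LinkDiagram) (f : Fin D.height → Bool) {p q : ℕ × ℕ} :
    (D.changeCrossings f).Joined p q ↔ D.Joined p q := by
  refine ⟨fun h => ?_, joined_changeCrossings_of_joined D f⟩
  have := joined_changeCrossings_of_joined (D.changeCrossings f) f h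
  rwa [changeCrossings_changeCrossings] at this

theorem numComponents_changeCrossings (D : LinkDiagram) (f : Fin D.height → Bool) :
    (D.changeCrossings f).numComponents = D.numComponents :=
  Nat.card_congr (Quot.congr (Equiv.refl _) fun _ _ => joined_changeCrossings_iff D f)

theorem IsDotted.changeCrossings (hD : D.IsDotted) (f : Fin D.height → Bool) :
    (D.changeCrossings f).IsDotted := by
  intro x
  obtain ⟨p, rfl⟩ := Quot.exists_rep x
  obtain ⟨k, q, hk, hq, hx⟩ := hD (D.component p)
  refine ⟨k, q, ?_, hq, ?_⟩
  · change (if f k then (D.slice k).piece.switch else (D.slice k).piece) = _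
    simp [hk, Piece.switch]
  · exact congrArg (Quot.map (fun p : D.Point => (p : (D.changeCrossings f).Point))
      fun _ _ h => joined_changeCrossings_of_joined D f h) hx

end LinkDiagram

theorem mainTheorem3 {G E : Type*} [CommGroup G] [Group E] [MulDistribMulAction G E]
    [Finite G] [Finite E] (𝒢 : CrossedModule G E) :
    (∀ (D : LinkDiagram), D.IsDotted → ∀ f : Fin D.height → Bool,
      (D.changeCrossings f).stateSum 𝒢 = D.stateSum 𝒢) ∧
    (∀ D D' : LinkDiagram, D.IsDotted → D'.IsDotted → D.numComponents = D'.numComponents →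
      D.stateSum 𝒢 = D'.stateSum 𝒢) := by
  have h : ∀ D D' : LinkDiagram, D.IsDotted → D'.IsDotted → D.numComponents = D'.numComponents →
      D.stateSum 𝒢 = D'.stateSum 𝒢 := fun D D' hD hD' h => by
    rw [LinkDiagram.stateSum_eq 𝒢 hD, LinkDiagram.stateSum_eq 𝒢 hD', h]
  exact ⟨fun D hD f => h _ _ (hD.changeCrossings f) hD (D.numComponents_changeCrossings f), h⟩
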